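/- Let $\mathcal{X}$ be a nonempty finite set, $\mathcal{H}_B$ a finite-dimensional complex Hilbert space with set of density operators $\mathcal{S}(\mathcal{H}_B)$, and $\mathscr{N}:x\mapsto\rho_B^x\in\mathcal{S}(\mathcal{H}_B)$ $(x\in\mathcal{X})$ a classical-quantum channel. For a probability distribution $p$ on $\mathcal{X}$ put $\rho_{XB}=\sum_x p(x)|x\rangle\langle x|\otimes\rho_B^x$ and $\rho_X=\sum_x p(x)|x\rangle\langle x|$. All logarithms are natural and all quantities take values in $[-\infty,+\infty]$. For $\rho,\sigma\ge 0$ with $\operatorname{Tr}\rho=1$, the measured Rényi divergence of order $\alpha\in[0,\infty]$ is $D^{\mathbb{M}}_\alpha(\rho\|\sigma)=\sup_{(\Pi_z)}D_\alpha\big((\operatorname{Tr}[\rho\Pi_z])_z\,\big\|\,(\operatorname{Tr}[\sigma\Pi_z])_z\big)$, the supremum being over POVMs with finitely many outcomes. Here $D_\alpha(P\|Q)=\frac{1}{\alpha-1}\log\sum_z P(z)^\alpha Q(z)^{1-\alpha}$ is the classical Rényi divergence (equal to $+\infty$ if $\alpha>1$ and $P\not\ll Q$), with $D_0(P\|Q)=-\log\sum_{z:P(z)>0}Q(z)$,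 with $D_1(P\|Q)=\sum_z P(z)\log\frac{P(z)}{Q(z)}$ ($+\infty$ if $P\not\ll Q$), and with $D_\infty(P\|Q)=\log\max_{z:P(z)>0}\frac{P(z)}{Q(z)}$. The sandwiched Rényi divergence is $D^{*}_\alpha(\rho\|\sigma)=\frac{1}{\alpha-1}\log\operatorname{Tr}\big[(\sigma^{\frac{1-\alpha}{2\alpha}}\rho\,\sigma^{\frac{1-\alpha}{2\alpha}})^\alpha\big]$ ($+\infty$ if $\alpha>1$ and $\operatorname{supp}\rho\not\subseteq\operatorname{supp}\sigma$; negative powers are taken on the support), with $D_1^*$ the Umegaki relative entropy $\operatorname{Tr}[\rho(\log\rho-\log\sigma)]$ ($+\infty$ if $\operatorname{supp}\rho\not\subseteq\operatorname{supp}\sigma$) and $D^*_\infty(\rho\|\sigma)=\inf\{t\in\mathbb{R}:\rho\le e^t\sigma\}$. For $t\in\{\mathbb{M},*\}$ define the Rényi capacity, the Arimoto capacity and the divergence radius by $$C_\alpha^{t}(\mathscr{N})=\sup_{p}\inf_{\sigma_B\in\mathcal{S}(\mathcal{H}_B)}D_\alpha^{t}(\rho_{XB}\|\rho_X\otimes\sigma_B),$$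 $$C_\alpha^{\mathrm{A},t}(\mathscr{N})=\sup_{p}\Big(H_\alpha(p)+\inf_{\sigma_B\in\mathcal{S}(\mathcal{H}_B)}D_\alpha^{t}(\rho_{XB}\|\mathbb{1}_X\otimes\sigma_B)\Big),$$ $$R_\alpha^{t}(\mathscr{N})=\inf_{\sigma_B\in\mathcal{S}(\mathcal{H}_B)}\sup_{x\in\mathcal{X}}D_\alpha^{t}(\rho_B^x\|\sigma_B),$$ where $p$ ranges over all probability distributions on $\mathcal{X}$ and $H_\alpha(p)=\frac{1}{1-\alpha}\log\sum_x p(x)^\alpha$ is the Rényi entropy (with $H_1$ the Shannon entropy and $H_\infty(p)=-\log\max_x p(x)$). Then: (i) $C_\alpha^{\mathbb{M}}(\mathscr{N})=R_\alpha^{\mathbb{M}}(\mathscr{N})$ for every $\alpha\in[0,\infty]$; (ii) $C_\alpha^{\mathrm{A},\mathbb{M}}(\mathscr{N})=C_\alpha^{\mathbb{M}}(\mathscr{N})$ for every $\alpha\in(0,\infty]$; (iii) $C_\alpha^{\mathrm{A},*}(\mathscr{N})=C_\alpha^{*}(\mathscr{N})=R_\alpha^{*}(\mathscr{N})$ for every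 $\alpha\in[1/2,\infty]$. -/

import Mathlib

noncomputable section

namespace CQRenyi

open scoped ENNReal Kronecker ComplexOrder

open scoped Classical in
/-- The classical Rényi divergence `D_α(P‖Q)` of order `α ∈ [0,∞]` (natural logarithm), for a finite
probability vector `P` and a finite nonnegative vector `Q`.  The orders `0, 1, ∞` are given by their
usual (limiting) expressions:
* `α = 0`: `-log ∑_{z : P z > 0} Q z`;
* `α = 1`: `∑ P log (P/Q)` if `P ≪ Q`, else `+∞`;
* `α = ∞`: `log max_z P z / Q z`;
* otherwise `(α - 1)⁻¹ log ∑ P^α Q^(1-α)`, which is `+∞` if `α > 1` and `P` is not `≪ Q`. -/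
def classicalRenyiDiv (α : ℝ≥0∞) {Z : Type*} [Fintype Z] (P Q : Z → ℝ) : EReal :=
  if α = 0 then
    -ENNReal.log (ENNReal.ofReal (∑ z, if P z = 0 then 0 else Q z))
  else if α = 1 then
    if ∀ z, Q z = 0 → P z = 0 then ((∑ z, P z * Real.log (P z / Q z) : ℝ) : EReal) else ⊤
  else if α = ⊤ then
    ⨆ z, ENNReal.log (ENNReal.ofReal (P z) / ENNReal.ofReal (Q z))
  else if α < 1 ∨ ∀ z, Q z = 0 → P z = 0 then
    (((α.toReal - 1)⁻¹ : ℝ) : EReal) *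
      ENNReal.log (ENNReal.ofReal (∑ z, P z ^ α.toReal * Q z ^ (1 - α.toReal)))
  else ⊤

section Operators

variable {n : Type*} [Fintype n] [DecidableEq n]

/-- A positive operator-valued measure with outcomes in the finite set `Z`. -/
structure POVM (n : Type*) [Fintype n] [DecidableEq n] (Z : Type*) [Fintype Z] where
  effect : Z → Matrix n n ℂ
  posSemidef : ∀ z, (effect z).PosSemidef
  sum_eq_one : ∑ z, effect z = 1

/-- The measured Rényi divergence `D_α^𝕄(ρ‖σ)`: the supremum, over all finite-outcome POVMs, of the
classical Rényi divergence of the two outcome distributions. -/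
def measuredRenyiDiv (α : ℝ≥0∞) (ρ σ : Matrix n n ℂ) : EReal :=
  ⨆ (k : ℕ) (E : POVM n (Fin k)),
    classicalRenyiDiv α (fun z => (ρ * E.effect z).trace.re) (fun z => (σ * E.effect z).trace.re)

/-- `supp ρ ⊆ supp σ` for positive semidefinite `ρ, σ`, expressed as `ker σ ⊆ ker ρ`. -/
def SuppLE (ρ σ : Matrix n n ℂ) : Prop :=
  ∀ v : n → ℂ, σ.mulVec v = 0 → ρ.mulVec v = 0

/-- The power `A ^ s` (`s ≠ 0`) of a positive semidefinite matrix, by functional calculus.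
As `0 ^ s = 0`, negative powers are taken on the support of `A`. -/
def mpow (A : Matrix n n ℂ) (s : ℝ) : Matrix n n ℂ := cfc (fun x : ℝ => x ^ s) A

/-- The logarithm of a positive semidefinite matrix, taken on its support
(`Real.log 0 = 0`). -/
def mlog (A : Matrix n n ℂ) : Matrix n n ℂ := cfc Real.log A

open scoped Classical in
/-- The Umegaki relative entropy `Tr[ρ (log ρ - log σ)]`, `+∞` if `supp ρ ⊄ supp σ`. -/
def relEntropy (ρ σ : Matrix n n ℂ) : EReal :=
  if SuppLE ρ σ then (((ρ * (mlog ρ - mlog σ)).trace.re : ℝ) : EReal) else ⊤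

/-- The max-relative entropy `inf {t : ρ ≤ e^t σ}`. -/
def maxRelEntropy (ρ σ : Matrix n n ℂ) : EReal :=
  ⨅ (t : ℝ) (_ : ((Real.exp t : ℂ) • σ - ρ).PosSemidef), (t : EReal)

open scoped Classical in
/-- The sandwiched Rényi divergence `D_α^*(ρ‖σ)` of order `α ∈ (0,∞]`:
the relative entropy for `α = 1`, the max-relative entropy for `α = ∞`, and otherwise
`(α - 1)⁻¹ log Tr[(σ^((1-α)/2α) ρ σ^((1-α)/2α))^α]`,
which is `+∞` if `α > 1` and `supp ρ ⊄ supp σ`. -/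
def sandwichedRenyiDiv (α : ℝ≥0∞) (ρ σ : Matrix n n ℂ) : EReal :=
  if α = 1 then relEntropy ρ σ
  else if α = ⊤ then maxRelEntropy ρ σ
  else if α < 1 ∨ SuppLE ρ σ then
    (((α.toReal - 1)⁻¹ : ℝ) : EReal) * ENNReal.log (ENNReal.ofReal
      (mpow (mpow σ ((1 - α.toReal) / (2 * α.toReal)) * ρ *
        mpow σ ((1 - α.toReal) / (2 * α.toReal))) α.toReal).trace.re)
  else ⊤

/-- The two families of quantum Rényi divergences. -/
inductive Family where
  | measured
  | sandwiched

/-- `D_α^{(t)}(ρ‖σ)`, where `t` stands for `𝕄` (measured) or `*` (sandwiched). -/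
def renyiDiv (t : Family) (α : ℝ≥0∞) (ρ σ : Matrix n n ℂ) : EReal :=
  match t with
  | Family.measured => measuredRenyiDiv α ρ σ
  | Family.sandwiched => sandwichedRenyiDiv α ρ σ

end Operators

/-- Density matrices: the set `𝒮(ℋ)` for `ℋ = ℂⁿ`. -/
abbrev DensityMatrix (n : Type*) [Fintype n] : Type _ :=
  {ρ : Matrix n n ℂ // ρ.PosSemidef ∧ ρ.trace = 1}

section Channels

variable {X B : Type*} [Fintype X] [DecidableEq X] [Fintype B] [DecidableEq B]

open scoped Classical in
/-- The classical Rényi entropy `H_α(X)_p` of order `α ∈ [0,∞]`. -/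
def renyiEntropy (α : ℝ≥0∞) (p : X → ℝ) : ℝ :=
  if α = 0 then Real.log (∑ x, if p x = 0 then 0 else 1)
  else if α = 1 then ∑ x, Real.negMulLog (p x)
  else if α = ⊤ then -Real.log (⨆ x, p x)
  else (1 - α.toReal)⁻¹ * Real.log (∑ x, p x ^ α.toReal)

/-- The c-q state `ρ_XB = ∑ₓ p(x) |x⟩⟨x| ⊗ ρ_B^x` produced by the c-q channel `N : x ↦ ρ_B^x` from the
input distribution `p`. -/
def cqState (p : stdSimplex ℝ X) (N : X → DensityMatrix B) : Matrix (X × B) (X × B) ℂ :=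
  ∑ x, (p.1 x : ℂ) • (Matrix.single x x (1 : ℂ) ⊗ₖ (N x).1)

/-- The classical marginal `ρ_X = ∑ₓ p(x) |x⟩⟨x|`. -/
def inputState (p : stdSimplex ℝ X) : Matrix X X ℂ :=
  Matrix.diagonal fun x => (p.1 x : ℂ)

/-- The Rényi information `I_α^{(t)}(X:B)_ρ = inf_σ D_α^{(t)}(ρ_XB ‖ ρ_X ⊗ σ_B)`. -/
def renyiInfo (t : Family) (α : ℝ≥0∞) (p : stdSimplex ℝ X) (N : X → DensityMatrix B) : EReal :=
  ⨅ σ : DensityMatrix B, renyiDiv t α (cqState p N) (inputState p ⊗ₖ σ.1)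

/-- The conditional Rényi entropy `H_α^{(t)}(X|B)_ρ = -inf_σ D_α^{(t)}(ρ_XB ‖ 1_X ⊗ σ_B)`. -/
def condRenyiEntropy (t : Family) (α : ℝ≥0∞) (p : stdSimplex ℝ X) (N : X → DensityMatrix B) :
    EReal :=
  -⨅ σ : DensityMatrix B, renyiDiv t α (cqState p N) ((1 : Matrix X X ℂ) ⊗ₖ σ.1)

/-- The Arimoto information `I_α^{A,(t)}(X:B)_ρ = H_α(X)_p - H_α^{(t)}(X|B)_ρ`. -/
def arimotoInfo (t : Family) (α : ℝ≥0∞) (p : stdSimplex ℝ X) (N : X → DensityMatrix B) : EReal :=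
  (renyiEntropy α p.1 : EReal) - condRenyiEntropy t α p N

/-- The Rényi capacity `C_α^{(t)}(N) = sup_p I_α^{(t)}(X:B)_ρ`. -/
def renyiCapacity (t : Family) (α : ℝ≥0∞) (N : X → DensityMatrix B) : EReal :=
  ⨆ p : stdSimplex ℝ X, renyiInfo t α p N

/-- The Arimoto capacity `C_α^{A,(t)}(N) = sup_p I_α^{A,(t)}(X:B)_ρ`. -/
def arimotoCapacity (t : Family) (α : ℝ≥0∞) (N : X → DensityMatrix B) : EReal :=
  ⨆ p : stdSimplex ℝ X, arimotoInfo t α p N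

/-- The Rényi divergence radius `R_α^{(t)}(N) = inf_σ sup_x D_α^{(t)}(ρ_B^x ‖ σ_B)`. -/
def divergenceRadius (t : Family) (α : ℝ≥0∞) (N : X → DensityMatrix B) : EReal :=
  ⨅ σ : DensityMatrix B, ⨆ x, renyiDiv t α (N x).1 σ.1

end Channels

end CQRenyi

end

noncomputable section

namespace CQRenyi

set_option linter.unusedSectionVars false

open scoped ENNReal Kronecker ComplexOrder

/-! Every divergence of finite order is replaced by a real trace functional `Q`, signed so that it
is convex in `σ`: `D ≤ r` holds exactly when `Q ≤ levelMap a r`, with infinite values of `D` encoded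
by failure of an epigraph predicate (`measuredEpi`, `sandwichedEpi`). Extended-real identities are
then checked on real upper bounds.

Against `ρ_X ⊗ σ` the functional of the c-q state is the `p`-average of the functionals of the
outputs. Capacity equals radius is therefore a minimax statement for an expression affine in `p` and
convex in `σ`. It is proved in `iSup_iInf_eq_iInf_iSup_of_epigraph` by separating a convex set of
value vectors from an orthant in `ℝ^X`; neither compactness nor semicontinuity in `σ` enters.

Against `1 ⊗ σ` the weights are `p ^ α` in place of `p`, plus a Shannon term at `α = 1`. Adding
`H_α(p)` divides by exactly the normalisation `∑ p ^ α`, so the Arimoto information of `p` is the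
Rényi information of its escort distribution. The escort map is surjective for `0 < α < ∞`, and the
two suprema agree (`arimotoCapacity_eq_renyiCapacity_of_epigraph`).

For the measured family, additivity over letters (`measuredEpi_cqState_iff`) and convexity
(`measuredEpi.convex`) both follow from subadditivity of perspectives of convex functions,
additivity using also that the letter may be measured first. For the sandwiched family, additivity
is block-diagonal functional calculus; convexity comes from operator convexity or concavity of the
power `(1 - a) / a` and of the logarithm, passed through the trace by Peierls' inequality. The bound
`a ≥ 1/2` puts that power in the operator concave range when `a < 1`.

At `α = ∞` both divergences reduce to the inequality `ρ ≤ e^r σ`, and the uniform distribution is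
optimal. -/

/-! ### Extended reals and the passage from divergences to trace functionals. -/

lemma ereal_le_of_forall_real {a b : EReal} (h : ∀ r : ℝ, b ≤ r → a ≤ r) : a ≤ b :=
  EReal.le_of_forall_lt_iff_le.1 fun r hr => h r hr.le

lemma ereal_eq_of_forall_real {a b : EReal} (h : ∀ r : ℝ, a ≤ r ↔ b ≤ r) : a = b :=
  le_antisymm (ereal_le_of_forall_real fun r hr => (h r).2 hr)
    (ereal_le_of_forall_real fun r hr => (h r).1 hr)

lemma coe_mul_le_coe_iff_of_pos {k : ℝ} (hk : 0 < k) (L : EReal) (r : ℝ) :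
    (k : EReal) * L ≤ r ↔ L ≤ ((r / k : ℝ) : EReal) := by
  induction L with
  | bot => simp [EReal.coe_mul_bot_of_pos hk]
  | top => simp [EReal.coe_mul_top_of_pos hk]
  | coe x =>
    rw [← EReal.coe_mul, EReal.coe_le_coe_iff, EReal.coe_le_coe_iff, le_div_iff₀ hk, mul_comm]

lemma coe_mul_le_coe_iff_of_neg {k : ℝ} (hk : k < 0) (L : EReal) (r : ℝ) :
    (k : EReal) * L ≤ r ↔ ((r / k : ℝ) : EReal) ≤ L := by
  induction L with
  | bot => simp [EReal.coe_mul_bot_of_neg hk]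
  | top => simp [EReal.coe_mul_top_of_neg hk]
  | coe x =>
    rw [← EReal.coe_mul, EReal.coe_le_coe_iff, EReal.coe_le_coe_iff, div_le_iff_of_neg hk, mul_comm]

lemma log_ofReal_le_coe_iff (q s : ℝ) :
    ENNReal.log (ENNReal.ofReal q) ≤ (s : EReal) ↔ q ≤ Real.exp s := by
  rw [← EReal.log_exp (s : EReal), ENNReal.log_le_log_iff, EReal.exp_coe,
    ENNReal.ofReal_le_ofReal_iff (Real.exp_pos s).le]

lemma coe_le_log_ofReal_iff (q s : ℝ) :
    (s : EReal) ≤ ENNReal.log (ENNReal.ofReal q) ↔ Real.exp s ≤ q := by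
  rw [← EReal.log_exp (s : EReal), ENNReal.log_le_log_iff, EReal.exp_coe]
  refine ⟨fun h => ?_, ENNReal.ofReal_le_ofReal⟩
  rcases le_total q 0 with hq | hq
  · rw [ENNReal.ofReal_of_nonpos hq] at h
    have := Real.exp_pos s
    simp only [nonpos_iff_eq_zero, ENNReal.ofReal_eq_zero] at h
    linarith
  · exact (ENNReal.ofReal_le_ofReal_iff hq).1 h

lemma inv_mul_log_le_iff_of_one_lt {a : ℝ} (ha : 1 < a) (q r : ℝ) :
    (((a - 1)⁻¹ : ℝ) : EReal) * ENNReal.log (ENNReal.ofReal q) ≤ r ↔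
      q ≤ Real.exp ((a - 1) * r) := by
  rw [coe_mul_le_coe_iff_of_pos (inv_pos.2 (sub_pos.2 ha)), log_ofReal_le_coe_iff, div_inv_eq_mul,
    mul_comm]

/-- The prefactor is negative and reverses the inequality; the two minus signs restore the form
"functional at most level" used for all orders. -/
lemma inv_mul_log_le_iff_of_lt_one {a : ℝ} (ha : a < 1) (q r : ℝ) :
    (((a - 1)⁻¹ : ℝ) : EReal) * ENNReal.log (ENNReal.ofReal q) ≤ r ↔
      -q ≤ -Real.exp ((a - 1) * r) := by
  rw [coe_mul_le_coe_iff_of_neg (inv_lt_zero.2 (sub_neg.2 ha)), coe_le_log_ofReal_iff,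
    div_inv_eq_mul, mul_comm, neg_le_neg_iff]

/-- The bijection `r ↦ ± exp ((a - 1) r)` (the identity for `a = 1`) that turns bounds on a Rényi
divergence of order `a` into bounds on the associated trace functional. -/
def levelMap (a r : ℝ) : ℝ :=
  if a = 1 then r else if a < 1 then -Real.exp ((a - 1) * r) else Real.exp ((a - 1) * r)

lemma levelMap_strictMono (a : ℝ) : StrictMono (levelMap a) := by
  intro r s hrs
  unfold levelMap
  split_ifs with h1 h2
  · exact hrs
  · exact neg_lt_neg (Real.exp_lt_exp.2 (mul_lt_mul_of_neg_left hrs (sub_neg.2 h2)))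
  · exact Real.exp_lt_exp.2 (mul_lt_mul_of_pos_left hrs
      (sub_pos.2 (lt_of_le_of_ne (not_lt.1 h2) (Ne.symm h1))))

/-- An entropy added to a divergence becomes a positive factor on the trace functional. -/
lemma levelMap_add {a : ℝ} (ha : a ≠ 1) (r s : ℝ) :
    levelMap a (r + s) = Real.exp ((a - 1) * s) * levelMap a r := by
  simp only [levelMap, if_neg ha, mul_add, Real.exp_add]
  split_ifs <;> ring

/-! ### Minimax by separation in a finite-dimensional space. -/

section Minimax

variable {X : Type*} [Fintype X]

/-- A convex set of vectors, each with a coordinate that is at least `V`, has a probability vector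
under which all averages are at least `V`. -/
lemma exists_stdSimplex_forall_le [Nonempty X] {A : Set (X → ℝ)} (hA : Convex ℝ A) {V : ℝ}
    (h : ∀ u ∈ A, ∃ x, V ≤ u x) :
    ∃ p ∈ stdSimplex ℝ X, ∀ u ∈ A, V ≤ ∑ x, p x * u x := by
  classical
  rcases A.eq_empty_or_nonempty with rfl | ⟨b, hb⟩
  · exact ⟨_, single_mem_stdSimplex ℝ (Classical.arbitrary X), by simp⟩
  have hS : {u : X → ℝ | ∀ x, u x < V} = Set.univ.pi fun _ => Set.Iio V := by
    ext u; simp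
  -- By hypothesis `A` misses the open orthant below `V`; the coefficients of the separating
  -- functional, normalised, are the required distribution.
  obtain ⟨f, s, hs, ht⟩ := geometric_hahn_banach_open (s := {u : X → ℝ | ∀ x, u x < V}) (t := A)
    (by rw [hS]; exact convex_pi fun _ _ => convex_Iio V)
    (by rw [hS]; exact isOpen_set_pi Set.finite_univ fun _ _ => isOpen_Iio) hA
    (Set.disjoint_left.2 fun u hu huA => by
      obtain ⟨x, hx⟩ := h u huA
      exact absurd (hu x) (not_lt.2 hx))
  set q : X → ℝ := fun x => f (Pi.single x 1) with hq
  have hf : ∀ u : X → ℝ, f u = ∑ x, q x * u x := fun u => by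
    have h1 := LinearMap.pi_apply_eq_sum_univ (f : (X → ℝ) →ₗ[ℝ] ℝ) u
    simp only [ContinuousLinearMap.coe_coe, smul_eq_mul] at h1
    rw [h1]
    refine Finset.sum_congr rfl fun x _ => ?_
    rw [mul_comm, hq]
    congr 2
    ext y
    simp [Pi.single_apply, eq_comm]
  have hq0 : ∀ x, 0 ≤ q x := by
    intro x
    by_contra hx
    push Not at hx
    -- The orthant is unbounded below in coordinate `x`. With a negative coefficient, a displacement
    -- of at least `(s - K) / (-q x)` in that direction would lift `f` to `s`.
    set K := f (fun _ => V - 1)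
    have h1 := hs ((fun _ => V - 1) - (max 0 ((s - K) / (-q x))) • Pi.single x (1 : ℝ)) (by
      intro y
      have : (0 : ℝ) ≤ max 0 ((s - K) / (-q x)) * (Pi.single x (1 : ℝ) : X → ℝ) y := by
        refine mul_nonneg (le_max_left _ _) ?_
        by_cases hxy : y = x
        · subst hxy; simp
        · simp [hxy]
      simp only [Pi.sub_apply, Pi.smul_apply, smul_eq_mul]
      linarith)
    rw [map_sub, map_smul, smul_eq_mul] at h1
    have h2 : (s - K) / (-q x) * (-q x) = s - K := div_mul_cancel₀ _ (by linarith)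
    have h3 : (s - K) / (-q x) * (-q x) ≤ max 0 ((s - K) / (-q x)) * (-q x) :=
      mul_le_mul_of_nonneg_right (le_max_right _ _) (by linarith)
    change K - _ * q x < s at h1
    linarith
  have hsum : 0 < ∑ x, q x := by
    rcases (Finset.sum_nonneg fun x _ => hq0 x).lt_or_eq with h0 | h0
    · exact h0
    · have h1 : ∀ x, q x = 0 := fun x =>
        (Finset.sum_eq_zero_iff_of_nonneg fun x _ => hq0 x).1 h0.symm x (Finset.mem_univ x)
      have h2 := hs (fun _ => V - 1) (fun _ => by linarith)
      have h3 := ht b hb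
      rw [hf] at h2 h3
      simp only [h1, zero_mul, Finset.sum_const_zero] at h2 h3
      linarith
  -- The corner `(V, …, V)` is approached from inside the orthant.
  have hV : V * ∑ x, q x ≤ s := by
    refine le_of_forall_pos_le_add fun ε hε => ?_
    have h1 := hs (fun _ => V - ε / ∑ x, q x) (fun _ => by
      have := div_pos hε hsum
      linarith)
    rw [hf, ← Finset.sum_mul] at h1
    have h2 : (∑ x, q x) * (ε / ∑ x, q x) = ε := mul_div_cancel₀ _ hsum.ne'
    nlinarith
  refine ⟨fun x => q x / ∑ y, q y, ⟨fun x => div_nonneg (hq0 x) hsum.le, ?_⟩, fun u hu => ?_⟩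
  · rw [← Finset.sum_div, div_self hsum.ne']
  · have h1 := ht u hu
    rw [hf] at h1
    have h2 : ∑ x, q x / (∑ y, q y) * u x = (∑ x, q x * u x) / ∑ y, q y := by
      rw [Finset.sum_div]
      exact Finset.sum_congr rfl fun x _ => by ring
    rw [h2, le_div_iff₀ hsum]
    linarith

/-- Minimax theorem for extended-real functions `D x` that are given through convex epigraphs
`E x`, and for their mixtures `I p`. -/
theorem iSup_iInf_eq_iInf_iSup_of_epigraph [Nonempty X] {S : Type*} (D : X → S → EReal)
    (I : stdSimplex ℝ X → S → EReal) (ψ : ℝ → ℝ) (hψ : StrictMono ψ) (E : X → S → ℝ → Prop)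
    (hE : ∀ x σ u v, E x σ u → u ≤ v → E x σ v)
    (hD : ∀ x σ (r : ℝ), D x σ ≤ r ↔ E x σ (ψ r))
    (hI : ∀ (p : stdSimplex ℝ X) σ (r : ℝ), I p σ ≤ r ↔
      ∃ u : X → ℝ, (∀ x, p.1 x ≠ 0 → E x σ (u x)) ∧ ∑ x, p.1 x * u x ≤ ψ r)
    (hconv : ∀ σ₁ σ₂ (u₁ u₂ : X → ℝ) (s t : ℝ), 0 < s → 0 < t → s + t = 1 →
      (∀ x, E x σ₁ (u₁ x)) → (∀ x, E x σ₂ (u₂ x)) →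
      ∃ σ, ∀ x, E x σ (s * u₁ x + t * u₂ x))
    (m : X → ℝ) (hm : ∀ x σ u, E x σ u → m x ≤ u) :
    ⨆ p, ⨅ σ, I p σ = ⨅ σ, ⨆ x, D x σ := by
  apply le_antisymm
  · refine iSup_le fun p => iInf_mono fun σ => ereal_le_of_forall_real fun r hr => ?_
    rw [hI]
    refine ⟨fun _ => ψ r, fun x _ => (hD x σ r).1 ((le_iSup (fun x => D x σ) x).trans hr), ?_⟩
    rw [← Finset.sum_mul, p.2.2, one_mul]
  · refine le_of_forall_lt fun c hc => ?_
    -- The level `r` is for the separation; the gap down to `r'` pays for perturbing the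
    -- distribution to full support.
    obtain ⟨r, hcr, hr⟩ := EReal.lt_iff_exists_real_btwn.1 hc
    obtain ⟨r', hcr', hr'⟩ := EReal.lt_iff_exists_real_btwn.1 hcr
    rw [EReal.coe_lt_coe_iff] at hr'
    refine hcr'.trans_le ?_
    have hconvA : Convex ℝ {u : X → ℝ | ∃ σ, ∀ x, E x σ (u x)} := by
      rw [convex_iff_forall_pos]
      rintro u₁ ⟨σ₁, h1⟩ u₂ ⟨σ₂, h2⟩ s t hs ht hst
      obtain ⟨σ, hσ⟩ := hconv σ₁ σ₂ u₁ u₂ s t hs ht hst h1 h2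
      exact ⟨σ, by simpa using hσ⟩
    obtain ⟨p, hp, hpA⟩ := exists_stdSimplex_forall_le hconvA (V := ψ r) (by
      rintro u ⟨σ, hσ⟩
      by_contra! hlt
      have : ⨆ x, D x σ ≤ r := iSup_le fun x => (hD x σ r).2 (hE x σ _ _ (hσ x) (hlt x).le)
      exact absurd (hr.trans_le ((iInf_le (fun σ => ⨆ x, D x σ) σ).trans this)) (lt_irrefl _))
    set N : ℝ := (Fintype.card X : ℝ)
    have hN : 0 < N := Nat.cast_pos.2 Fintype.card_pos
    obtain ⟨M, hM⟩ : ∃ M : ℝ, ∀ x, M ≤ m x := by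
      obtain ⟨x, hx⟩ := Finite.exists_min m
      exact ⟨m x, hx⟩
    have hgap : 0 < ψ r - ψ r' := sub_pos.2 (hψ hr')
    -- This choice makes mixing in a fraction `ε` of the uniform distribution cost at most half of
    -- the gap, given that all values are at least `M`.
    set K := ψ r - ψ r' + |ψ r - M| with hK
    have hKpos : 0 < K := by positivity
    set ε := (ψ r - ψ r') / (2 * K) with hε
    have hεpos : 0 < ε := by positivity
    have hε1 : ε < 1 := by
      rw [hε, div_lt_one (by positivity)]
      have := abs_nonneg (ψ r - M)
      linarith
    have hεM : ε * (ψ r - M) < ψ r - ψ r' := by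
      have h1 : ε * (ψ r - M) ≤ ε * K :=
        mul_le_mul_of_nonneg_left ((le_abs_self _).trans (by linarith)) hεpos.le
      have h2 : ε * K = (ψ r - ψ r') / 2 := by
        rw [hε]; field_simp
      linarith
    -- Full support is essential: `I p` ignores letters of probability zero, where the epigraph over
    -- `σ` may be empty.
    let p' : stdSimplex ℝ X := ⟨fun x => (1 - ε) * p x + ε / N, fun x => by
        have := hp.1 x
        have : 0 ≤ 1 - ε := by linarith
        positivity, by
        rw [Finset.sum_add_distrib, ← Finset.mul_sum, hp.2, Finset.sum_const, Finset.card_univ,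
          nsmul_eq_mul]
        field_simp
        ring⟩
    have hp' : ∀ x, p'.1 x ≠ 0 := fun x => by
      have := hp.1 x
      have h1 : 0 ≤ 1 - ε := by linarith
      have : 0 < (1 - ε) * p x + ε / N := by positivity
      exact this.ne'
    refine le_trans (le_iInf fun σ => ?_) (le_iSup (fun p => ⨅ σ, I p σ) p')
    by_contra hlt
    obtain ⟨u, hu, hsum⟩ := (hI p' σ r').1 (not_le.1 hlt).le
    have hu' : ∀ x, E x σ (u x) := fun x => hu x (hp' x)
    have h1 : ψ r ≤ ∑ x, p x * u x := hpA u ⟨σ, hu'⟩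
    have h2 : N * M ≤ ∑ x, u x := by
      have : ∑ _x : X, M ≤ ∑ x, u x :=
        Finset.sum_le_sum fun x _ => (hM x).trans (hm x σ _ (hu' x))
      simpa [N] using this
    have h3 : ∑ x, p'.1 x * u x = (1 - ε) * ∑ x, p x * u x + ε / N * ∑ x, u x := by
      simp only [p', add_mul, Finset.sum_add_distrib, Finset.mul_sum, mul_assoc]
    have h4 : ε * M ≤ ε / N * ∑ x, u x := by
      calc ε * M = ε / N * (N * M) := by field_simp
        _ ≤ _ := mul_le_mul_of_nonneg_left h2 (by positivity)
    have h5 : (1 - ε) * ψ r ≤ (1 - ε) * ∑ x, p x * u x :=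
      mul_le_mul_of_nonneg_left h1 (by linarith)
    rw [h3] at hsum
    nlinarith

end Minimax

/-! ### Arimoto information and escort distributions. -/

section Arimoto

lemma coe_add_le_coe_iff (h : ℝ) (y : EReal) (r : ℝ) :
    (h : EReal) + y ≤ r ↔ y ≤ ((r - h : ℝ) : EReal) := by
  induction y with
  | bot => simp
  | top => rw [EReal.coe_add_top]; simp only [top_le_iff, EReal.coe_ne_top]
  | coe x =>
    rw [← EReal.coe_add, EReal.coe_le_coe_iff, EReal.coe_le_coe_iff, le_sub_iff_add_le, add_comm]

lemma coe_add_iInf {ι : Sort*} (h : ℝ) (y : ι → EReal) :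
    (h : EReal) + ⨅ i, y i = ⨅ i, ((h : EReal) + y i) := by
  apply le_antisymm
  · exact le_iInf fun i => add_le_add_right (iInf_le y i) _
  · have h1 : (⨅ i, ((h : EReal) + y i)) - h ≤ ⨅ i, y i := by
      refine le_iInf fun i => ?_
      rw [EReal.sub_le_iff_le_add (by simp) (by simp), add_comm]
      exact iInf_le _ i
    rw [EReal.sub_le_iff_le_add (by simp) (by simp), add_comm] at h1
    exact h1

variable {X B : Type*} [Fintype X] [Fintype B] [DecidableEq B]

lemma arimotoInfo_eq [DecidableEq X] (t : Family) (α : ℝ≥0∞) (p : stdSimplex ℝ X) (N : X → DensityMatrix B) :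
    arimotoInfo t α p N = ⨅ σ : DensityMatrix B,
      ((renyiEntropy α p.1 : ℝ) : EReal) + renyiDiv t α (cqState p N) ((1 : Matrix X X ℂ) ⊗ₖ σ.1) := by
  rw [arimotoInfo, condRenyiEntropy, sub_eq_add_neg, neg_neg, coe_add_iInf]

lemma stdSimplex_sum_rpow_pos (p : stdSimplex ℝ X) (a : ℝ) : 0 < ∑ x, p.1 x ^ a := by
  have h0 : ∀ x, 0 ≤ p.1 x ^ a := fun x => Real.rpow_nonneg (p.2.1 x) a
  refine (Finset.sum_nonneg fun x _ => h0 x).lt_of_ne' fun h => ?_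
  have h1 : ∀ x, p.1 x = 0 := fun x => by
    have h2 := (Finset.sum_eq_zero_iff_of_nonneg fun x _ => h0 x).1 h x (Finset.mem_univ x)
    by_contra hx
    exact (Real.rpow_pos_of_pos ((p.2.1 x).lt_of_ne' hx) a).ne' h2
  have h3 := p.2.2
  simp [h1] at h3

/-- The escort distribution `p ^ a / ∑ p ^ a`. -/
def escort (a : ℝ) (p : stdSimplex ℝ X) : stdSimplex ℝ X :=
  ⟨fun x => p.1 x ^ a / ∑ y, p.1 y ^ a,
    fun x => div_nonneg (Real.rpow_nonneg (p.2.1 x) a) (stdSimplex_sum_rpow_pos p a).le, by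
    rw [← Finset.sum_div, div_self (stdSimplex_sum_rpow_pos p a).ne']⟩

/-- The escort of order `a⁻¹` is a right inverse, since normalisation constants cancel. -/
lemma escort_surjective {a : ℝ} (ha : a ≠ 0) :
    Function.Surjective (escort a : stdSimplex ℝ X → stdSimplex ℝ X) := by
  intro q
  refine ⟨escort a⁻¹ q, Subtype.ext (funext fun x => ?_)⟩
  have hW := stdSimplex_sum_rpow_pos q a⁻¹
  have h : ∀ y, (escort a⁻¹ q).1 y ^ a = q.1 y / (∑ z, q.1 z ^ a⁻¹) ^ a := fun y => by
    change (q.1 y ^ a⁻¹ / ∑ z, q.1 z ^ a⁻¹) ^ a = _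
    rw [Real.div_rpow (Real.rpow_nonneg (q.2.1 y) _) hW.le, ← Real.rpow_mul (q.2.1 y),
      inv_mul_cancel₀ ha, Real.rpow_one]
  change (escort a⁻¹ q).1 x ^ a / ∑ y, (escort a⁻¹ q).1 y ^ a = q.1 x
  simp only [h]
  rw [← Finset.sum_div, q.2.2]
  rw [div_div_div_cancel_right₀ (Real.rpow_pos_of_pos hW a).ne', div_one]

lemma escort_ne_zero_iff {a : ℝ} (ha : a ≠ 0) (p : stdSimplex ℝ X) (x : X) :
    (escort a p).1 x ≠ 0 ↔ p.1 x ≠ 0 := by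
  change p.1 x ^ a / _ ≠ 0 ↔ _
  rw [div_ne_zero_iff, Real.rpow_ne_zero (p.2.1 x) ha]
  exact and_iff_left (stdSimplex_sum_rpow_pos p a).ne'

theorem arimotoCapacity_eq_renyiCapacity_of_epigraph [DecidableEq X] (t : Family) {α : ℝ≥0∞} (h0 : α ≠ 0)
    (htop : α ≠ ⊤) (N : X → DensityMatrix B) (E : X → DensityMatrix B → ℝ → Prop)
    (hI : ∀ (p : stdSimplex ℝ X) (σ : DensityMatrix B) (r : ℝ),
      renyiDiv t α (cqState p N) (inputState p ⊗ₖ σ.1) ≤ r ↔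
      ∃ u : X → ℝ, (∀ x, p.1 x ≠ 0 → E x σ (u x)) ∧ ∑ x, p.1 x * u x ≤ levelMap α.toReal r)
    (hA : ∀ (p : stdSimplex ℝ X) (σ : DensityMatrix B) (r : ℝ),
      renyiDiv t α (cqState p N) ((1 : Matrix X X ℂ) ⊗ₖ σ.1) ≤ r ↔
      ∃ u : X → ℝ, (∀ x, p.1 x ≠ 0 → E x σ (u x)) ∧
        ∑ x, p.1 x ^ α.toReal * u x + (if α = 1 then ∑ x, p.1 x * Real.log (p.1 x) else 0) ≤
          levelMap α.toReal r) :
    arimotoCapacity t α N = renyiCapacity t α N := by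
  have ha : α.toReal ≠ 0 := ENNReal.toReal_ne_zero.2 ⟨h0, htop⟩
  have key : ∀ p, arimotoInfo t α p N = renyiInfo t α (escort α.toReal p) N := fun p => by
    rw [arimotoInfo_eq, renyiInfo]
    refine iInf_congr fun σ => ereal_eq_of_forall_real fun r => ?_
    rw [coe_add_le_coe_iff, hA, hI]
    simp only [escort_ne_zero_iff ha]
    refine exists_congr fun u => and_congr_right fun _ => ?_
    have hZ := stdSimplex_sum_rpow_pos p α.toReal
    have hsum : ∑ x, (escort α.toReal p).1 x * u x =
        (∑ x, p.1 x ^ α.toReal * u x) / ∑ x, p.1 x ^ α.toReal := by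
      rw [Finset.sum_div]
      exact Finset.sum_congr rfl fun x _ => by
        change p.1 x ^ α.toReal / _ * _ = _
        ring
    rw [hsum, div_le_iff₀ hZ]
    -- At order one the escort distribution is `p` itself and `∑ p log p` cancels the Shannon
    -- entropy; otherwise `levelMap_add` turns the entropy into the factor `∑ p ^ α`.
    by_cases h1 : α = 1
    · subst h1
      have hp := p.2.2
      simp only [renyiEntropy, levelMap, ENNReal.toReal_one, Real.rpow_one, if_true,
        one_ne_zero, if_false, Real.negMulLog, neg_mul, Finset.sum_neg_distrib, hp, mul_one]
      constructor <;> intro h <;> linarith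
    · have h1' : α.toReal ≠ 1 := fun h => h1 (by
        rw [← ENNReal.ofReal_toReal htop, h, ENNReal.ofReal_one])
      simp only [renyiEntropy, h0, h1, htop, if_false, add_zero]
      rw [sub_eq_add_neg, levelMap_add h1']
      have h2 : (α.toReal - 1) * -((1 - α.toReal)⁻¹ * Real.log (∑ x, p.1 x ^ α.toReal)) =
          Real.log (∑ x, p.1 x ^ α.toReal) := by
        have : 1 - α.toReal ≠ 0 := sub_ne_zero.2 (Ne.symm h1')
        field_simp
        ring
      rw [h2, Real.exp_log hZ, mul_comm]
  rw [arimotoCapacity, renyiCapacity]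
  simp only [key]
  exact (escort_surjective ha).iSup_comp (fun p => renyiInfo t α p N)

end Arimoto

/-! ### Quadratic forms and positive semidefinite matrices. -/

section Positivity

open scoped MatrixOrder

variable {n : Type*} [Fintype n]

/-- The real part of the quadratic form of a matrix. -/
def quadForm (A : Matrix n n ℂ) (v : n → ℂ) : ℝ := (star v ⬝ᵥ A.mulVec v).re

lemma quadForm_add (A B : Matrix n n ℂ) (v : n → ℂ) :
    quadForm (A + B) v = quadForm A v + quadForm B v := by
  simp [quadForm, Matrix.add_mulVec]

lemma quadForm_sub (A B : Matrix n n ℂ) (v : n → ℂ) :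
    quadForm (A - B) v = quadForm A v - quadForm B v := by
  simp [quadForm, Matrix.sub_mulVec]

lemma quadForm_smul (c : ℝ) (A : Matrix n n ℂ) (v : n → ℂ) :
    quadForm ((c : ℂ) • A) v = c * quadForm A v := by
  simp [quadForm, Matrix.smul_mulVec]

lemma quadForm_nonneg {A : Matrix n n ℂ} (hA : A.PosSemidef) (v : n → ℂ) : 0 ≤ quadForm A v :=
  (Complex.nonneg_iff.1 (hA.dotProduct_mulVec_nonneg v)).1

lemma posSemidef_of_quadForm_nonneg {A : Matrix n n ℂ} (hA : A.IsHermitian)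
    (h : ∀ v, 0 ≤ quadForm A v) : A.PosSemidef :=
  .of_dotProduct_mulVec_nonneg hA fun v =>
    Complex.nonneg_iff.2 ⟨h v, (hA.im_star_dotProduct_mulVec_self v).symm⟩

lemma isSelfAdjoint_ofReal (c : ℝ) : IsSelfAdjoint (c : ℂ) := by simp [isSelfAdjoint_iff]

lemma PosSemidef.real_smul {A : Matrix n n ℂ} (hA : A.PosSemidef) {c : ℝ} (hc : 0 ≤ c) :
    ((c : ℂ) • A).PosSemidef := hA.smul (by exact_mod_cast hc)

lemma trace_mul_re_nonneg [DecidableEq n] {A B : Matrix n n ℂ} (hA : A.PosSemidef)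
    (hB : B.PosSemidef) : 0 ≤ (A * B).trace.re := by
  obtain ⟨C, rfl⟩ := CStarAlgebra.nonneg_iff_eq_star_mul_self.mp hA.nonneg
  rw [Matrix.mul_assoc, Matrix.trace_mul_comm]
  exact (Complex.nonneg_iff.1 (hB.mul_mul_conjTranspose_same C).trace_nonneg).1

lemma trace_mul_vecMulVec_re (A : Matrix n n ℂ) (v : n → ℂ) :
    (A * Matrix.vecMulVec v (star v)).trace.re = quadForm A v := by
  rw [Matrix.mul_vecMulVec, Matrix.trace_vecMulVec, dotProduct_comm]
  rfl

end Positivity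

/-! ### Block-diagonal matrices on `X × B`. -/

section Blocks

variable {X B : Type*} [DecidableEq X]

/-- The block diagonal matrix `∑ₓ |x⟩⟨x| ⊗ M x`. -/
def blockSum (M : X → Matrix B B ℂ) : Matrix (X × B) (X × B) ℂ :=
  Matrix.of fun i j => if i.1 = j.1 then M i.1 i.2 j.2 else 0

/-- The diagonal block `(⟨x| ⊗ 1) A (|x⟩ ⊗ 1)`. -/
def block (x : X) (A : Matrix (X × B) (X × B) ℂ) : Matrix B B ℂ :=
  A.submatrix (fun b => (x, b)) (fun b => (x, b))

lemma diagonal_kronecker_eq (w : X → ℂ) (σ : Matrix B B ℂ) :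
    Matrix.diagonal w ⊗ₖ σ = blockSum fun x => w x • σ := by
  ext ⟨x, b⟩ ⟨y, c⟩
  by_cases h : x = y <;> simp [blockSum, h]

lemma one_kronecker_eq (σ : Matrix B B ℂ) :
    (1 : Matrix X X ℂ) ⊗ₖ σ = blockSum fun _ => ((1 : ℝ) : ℂ) • σ := by
  rw [← Matrix.diagonal_one, diagonal_kronecker_eq]
  simp

lemma blockSum_sub (M M' : X → Matrix B B ℂ) :
    blockSum M - blockSum M' = blockSum fun x => M x - M' x := by
  ext ⟨x, b⟩ ⟨y, c⟩
  by_cases h : x = y <;> simp [blockSum, h]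

lemma blockSum_add (M M' : X → Matrix B B ℂ) :
    blockSum M + blockSum M' = blockSum fun x => M x + M' x := by
  ext ⟨x, b⟩ ⟨y, c⟩
  by_cases h : x = y <;> simp [blockSum, h]

lemma blockSum_smul (k : ℂ) (M : X → Matrix B B ℂ) :
    k • blockSum M = blockSum fun x => k • M x := by
  ext ⟨x, b⟩ ⟨y, c⟩
  by_cases h : x = y <;> simp [blockSum, h]

lemma blockSum_one [DecidableEq B] : blockSum (fun _ : X => (1 : Matrix B B ℂ)) = 1 := by
  ext ⟨x, b⟩ ⟨y, c⟩
  by_cases h : x = y <;> simp [blockSum, h, Matrix.one_apply]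

lemma block_blockSum (M : X → Matrix B B ℂ) (x : X) : block x (blockSum M) = M x := by
  ext b c
  simp [block, blockSum]

lemma blockSum_conjTranspose (M : X → Matrix B B ℂ) :
    (blockSum M).conjTranspose = blockSum fun x => (M x).conjTranspose := by
  ext ⟨x, b⟩ ⟨y, c⟩
  by_cases h : x = y
  · subst h; simp [blockSum]
  · simp [blockSum, h, Ne.symm h]

variable [Fintype X] [Fintype B]

lemma cqState_eq [DecidableEq B] (p : stdSimplex ℝ X) (N : X → DensityMatrix B) :
    cqState p N = blockSum fun x => (p.1 x : ℂ) • (N x).1 := by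
  ext ⟨x, b⟩ ⟨y, c⟩
  by_cases h : x = y
  · subst h
    simp [cqState, blockSum, Matrix.sum_apply, Matrix.single_apply]
  · have : ∀ z, ¬ (z = x ∧ z = y) := fun z hz => h (hz.1.symm.trans hz.2)
    simp [cqState, blockSum, Matrix.sum_apply, h, this]

lemma blockSum_mul (M M' : X → Matrix B B ℂ) :
    blockSum M * blockSum M' = blockSum fun x => M x * M' x := by
  ext ⟨x, b⟩ ⟨y, c⟩
  simp only [blockSum, Matrix.mul_apply, Matrix.of_apply, Fintype.sum_prod_type, ite_mul, zero_mul]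
  rw [Finset.sum_eq_single x (fun z _ hz => by simp [hz.symm]) (by simp)]
  by_cases h : x = y <;> simp [h]

lemma trace_blockSum_mul (M : X → Matrix B B ℂ) (A : Matrix (X × B) (X × B) ℂ) :
    (blockSum M * A).trace = ∑ x, (M x * block x A).trace := by
  simp only [Matrix.trace, Matrix.diag, Matrix.mul_apply, Fintype.sum_prod_type, blockSum, block,
    Matrix.of_apply, ite_mul, zero_mul, Matrix.submatrix_apply]
  refine Finset.sum_congr rfl fun x _ => Finset.sum_congr rfl fun b _ => ?_
  rw [Finset.sum_eq_single x (fun z _ hz => by simp [hz.symm]) (by simp)]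
  simp

lemma trace_blockSum (M : X → Matrix B B ℂ) : (blockSum M).trace = ∑ x, (M x).trace := by
  simp [Matrix.trace, Fintype.sum_prod_type, blockSum]

lemma blockSum_mulVec (M : X → Matrix B B ℂ) (v : X × B → ℂ) (x : X) (b : B) :
    (blockSum M).mulVec v (x, b) = (M x).mulVec (fun c => v (x, c)) b := by
  simp only [Matrix.mulVec, dotProduct, Fintype.sum_prod_type, blockSum, Matrix.of_apply, ite_mul,
    zero_mul]
  rw [Finset.sum_eq_single x (fun z _ hz => by simp [hz.symm]) (by simp)]
  simp

lemma posSemidef_blockSum_iff (M : X → Matrix B B ℂ) :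
    (blockSum M).PosSemidef ↔ ∀ x, (M x).PosSemidef := by
  refine ⟨fun h x => ?_, fun h => ?_⟩
  · rw [← block_blockSum M x]
    exact h.submatrix _
  · refine .of_dotProduct_mulVec_nonneg ?_ fun v => ?_
    · rw [Matrix.IsHermitian, blockSum_conjTranspose]
      simp only [(h _).1.eq]
    · rw [dotProduct, Fintype.sum_prod_type]
      refine Finset.sum_nonneg fun x _ => ?_
      simp only [blockSum_mulVec]
      exact (h x).dotProduct_mulVec_nonneg fun c => v (x, c)

end Blocks

/-! ### Order infinity as an operator inequality. -/

section MaxDivergence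

variable {n : Type*} [Fintype n] [DecidableEq n]

/-- The admissible exponents form an up-set because `σ ≥ 0`, and it is closed: each quadratic form
is continuous in the exponent. Hence a real infimum is attained. -/
lemma maxRelEntropy_le_iff {ρ σ : Matrix n n ℂ} (hρ : ρ.PosSemidef) (hσ : σ.PosSemidef) (r : ℝ) :
    maxRelEntropy ρ σ ≤ r ↔ ((Real.exp r : ℂ) • σ - ρ).PosSemidef := by
  refine ⟨fun h => ?_, fun h => iInf₂_le r h⟩
  have hherm : ∀ c : ℝ, ((c : ℂ) • σ - ρ).IsHermitian := fun c =>
    (hσ.1.smul (isSelfAdjoint_ofReal c)).sub hρ.1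
  have hlt : ∀ s : ℝ, r < s → ∀ v, 0 ≤ Real.exp s * quadForm σ v - quadForm ρ v := by
    intro s hs v
    have h1 : maxRelEntropy ρ σ < s := h.trans_lt (by exact_mod_cast hs)
    rw [maxRelEntropy, iInf_lt_iff] at h1
    obtain ⟨t, ht⟩ := h1
    rw [iInf_lt_iff] at ht
    obtain ⟨hpsd, hts⟩ := ht
    have h2 := quadForm_nonneg hpsd v
    rw [quadForm_sub, quadForm_smul] at h2
    have h3 : Real.exp t ≤ Real.exp s := Real.exp_le_exp.2 (by exact_mod_cast hts.le)
    nlinarith [quadForm_nonneg hσ v]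
  refine posSemidef_of_quadForm_nonneg (hherm _) fun v => ?_
  rw [quadForm_sub, quadForm_smul]
  have hc : Filter.Tendsto (fun s => Real.exp s * quadForm σ v - quadForm ρ v)
      (nhdsWithin r (Set.Ioi r)) (nhds (Real.exp r * quadForm σ v - quadForm ρ v)) :=
    (Continuous.tendsto (by fun_prop) r).mono_left nhdsWithin_le_nhds
  exact ge_of_tendsto hc (Filter.eventually_of_mem self_mem_nhdsWithin fun s hs => hlt s hs v)

/-- The two-outcome measurement that tests for the direction of a nonzero vector. -/
def rankOnePOVM (v : n → ℂ) (s : ℝ) (hs : 0 < s) (hv : star v ⬝ᵥ v = (s : ℂ)) : POVM n (Fin 2) where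
  effect := ![((s⁻¹ : ℝ) : ℂ) • Matrix.vecMulVec v (star v),
    1 - ((s⁻¹ : ℝ) : ℂ) • Matrix.vecMulVec v (star v)]
  posSemidef := by
    have hP := PosSemidef.real_smul (Matrix.posSemidef_vecMulVec_self_star v) (inv_nonneg.2 hs.le)
    -- Idempotence makes the complementary effect a square `(1 - P)ᴴ (1 - P)`, hence positive.
    have hidem : (((s⁻¹ : ℝ) : ℂ) • Matrix.vecMulVec v (star v)) *
        (((s⁻¹ : ℝ) : ℂ) • Matrix.vecMulVec v (star v)) =
        ((s⁻¹ : ℝ) : ℂ) • Matrix.vecMulVec v (star v) := by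
      rw [smul_mul_smul_comm, Matrix.vecMulVec_mul_vecMulVec, hv]
      ext i j
      have : (s : ℂ) ≠ 0 := by exact_mod_cast hs.ne'
      simp [Matrix.vecMulVec_apply]
      field_simp
    intro z
    fin_cases z
    · exact hP
    · set P := ((s⁻¹ : ℝ) : ℂ) • Matrix.vecMulVec v (star v)
      have h1 : (1 - P).conjTranspose * (1 - P) = 1 - P := by
        rw [Matrix.conjTranspose_sub, Matrix.conjTranspose_one, hP.1.eq, sub_mul, mul_sub, mul_sub,
          hidem]
        simp
      change (1 - P).PosSemidef
      rw [← h1]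
      exact Matrix.posSemidef_conjTranspose_mul_self _
  sum_eq_one := by simp [Fin.sum_univ_two]

/-- Rank-one tests recover the quadratic form of `e^r σ - ρ` in every direction; conversely a
positive operator has nonnegative trace against every effect. -/
lemma measuredRenyiDiv_top_le_iff {ρ σ : Matrix n n ℂ} (hρ : ρ.PosSemidef) (hσ : σ.PosSemidef)
    (r : ℝ) : measuredRenyiDiv ⊤ ρ σ ≤ r ↔ ((Real.exp r : ℂ) • σ - ρ).PosSemidef := by
  have key : ∀ (k : ℕ) (E : POVM n (Fin k)) (z : Fin k),
      ENNReal.log (ENNReal.ofReal (ρ * E.effect z).trace.re /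
        ENNReal.ofReal (σ * E.effect z).trace.re) ≤ r ↔
      (ρ * E.effect z).trace.re ≤ Real.exp r * (σ * E.effect z).trace.re := by
    intro k E z
    have h0 := trace_mul_re_nonneg hσ (E.posSemidef z)
    rw [← EReal.log_exp (r : EReal), ENNReal.log_le_log_iff, EReal.exp_coe,
      ENNReal.div_le_iff_le_mul (Or.inr ENNReal.ofReal_ne_top)
        (Or.inl ENNReal.ofReal_ne_top), ← ENNReal.ofReal_mul (Real.exp_pos r).le,
      ENNReal.ofReal_le_ofReal_iff (mul_nonneg (Real.exp_pos r).le h0)]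
  simp only [measuredRenyiDiv, classicalRenyiDiv, ENNReal.top_ne_zero, ENNReal.top_ne_one, if_false,
    if_true, iSup_le_iff, key]
  constructor
  · intro h
    refine posSemidef_of_quadForm_nonneg
      ((hσ.1.smul (isSelfAdjoint_ofReal _)).sub hρ.1) fun v => ?_
    rw [quadForm_sub, quadForm_smul, sub_nonneg]
    obtain rfl | hv := eq_or_ne v 0
    · simp [quadForm]
    have hpos := Matrix.dotProduct_star_self_pos_iff.2 hv
    obtain ⟨h1, h2⟩ := Complex.pos_iff.1 hpos
    set s := (star v ⬝ᵥ v).re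
    have hs : star v ⬝ᵥ v = (s : ℂ) := Complex.ext rfl (by simpa using h2.symm)
    have h3 := h 2 (rankOnePOVM v s h1 hs) 0
    have h4 : ∀ A : Matrix n n ℂ, (A * (rankOnePOVM v s h1 hs).effect 0).trace.re =
        s⁻¹ * quadForm A v := fun A => by
      change (A * (((s⁻¹ : ℝ) : ℂ) • Matrix.vecMulVec v (star v))).trace.re = _
      rw [Matrix.mul_smul, Matrix.trace_smul, smul_eq_mul, Complex.re_ofReal_mul,
        trace_mul_vecMulVec_re]
    rw [h4, h4, mul_left_comm] at h3
    exact le_of_mul_le_mul_left h3 (inv_pos.2 h1)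
  · intro h k E z
    have h1 := trace_mul_re_nonneg h (E.posSemidef z)
    rw [sub_mul, Matrix.trace_sub, Matrix.smul_mul, Matrix.trace_smul, smul_eq_mul, Complex.sub_re,
      Complex.re_ofReal_mul] at h1
    linarith

lemma renyiDiv_top_le_iff (t : Family) {ρ σ : Matrix n n ℂ} (hρ : ρ.PosSemidef)
    (hσ : σ.PosSemidef) (r : ℝ) :
    renyiDiv t ⊤ ρ σ ≤ r ↔ ((Real.exp r : ℂ) • σ - ρ).PosSemidef := by
  cases t with
  | measured => exact measuredRenyiDiv_top_le_iff hρ hσ r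
  | sandwiched =>
    simp only [renyiDiv, sandwichedRenyiDiv, ENNReal.top_ne_one, if_false, if_true]
    exact maxRelEntropy_le_iff hρ hσ r

end MaxDivergence

/-! ### Capacities and radius at order infinity. -/

section MaxCapacity

variable {X B : Type*} [Fintype X] [DecidableEq X] [Fintype B] [DecidableEq B]

lemma posSemidef_cqState (p : stdSimplex ℝ X) (N : X → DensityMatrix B) :
    (cqState p N).PosSemidef := by
  rw [cqState_eq, posSemidef_blockSum_iff]
  exact fun x => PosSemidef.real_smul (N x).2.1 (p.2.1 x)

lemma renyiDiv_top_cqState_le_iff (t : Family) (p : stdSimplex ℝ X) (w : X → ℝ) (hw : ∀ x, 0 ≤ w x)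
    (N : X → DensityMatrix B) (σ : DensityMatrix B) (r : ℝ) :
    renyiDiv t ⊤ (cqState p N) (blockSum fun x => (w x : ℂ) • σ.1) ≤ r ↔
      ∀ x, (((Real.exp r * w x : ℝ) : ℂ) • σ.1 - (p.1 x : ℂ) • (N x).1).PosSemidef := by
  rw [renyiDiv_top_le_iff t (posSemidef_cqState p N)
    ((posSemidef_blockSum_iff _).2 fun x => PosSemidef.real_smul σ.2.1 (hw x)), cqState_eq,
    blockSum_smul, blockSum_sub, posSemidef_blockSum_iff]
  simp only [smul_smul, Complex.ofReal_mul, Complex.ofReal_exp]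

variable [Nonempty X]

/-- The uniform distribution. -/
def uniformDist (X : Type*) [Fintype X] [Nonempty X] : stdSimplex ℝ X :=
  ⟨fun _ => (Fintype.card X : ℝ)⁻¹, fun _ => by positivity, by simp⟩

lemma iSup_renyiDiv_top_le_iff (t : Family) (N : X → DensityMatrix B) (σ : DensityMatrix B)
    (r : ℝ) : ⨆ x, renyiDiv t ⊤ (N x).1 σ.1 ≤ r ↔
      ∀ x, (((Real.exp r : ℝ) : ℂ) • σ.1 - (N x).1).PosSemidef := by
  simp only [iSup_le_iff, renyiDiv_top_le_iff t (N _).2.1 σ.2.1, Complex.ofReal_exp]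

lemma posSemidef_smul_iff {n : Type*} [Fintype n] {c : ℝ} (hc : 0 < c) (A : Matrix n n ℂ) :
    ((c : ℂ) • A).PosSemidef ↔ A.PosSemidef := by
  refine ⟨fun h => ?_, fun h => PosSemidef.real_smul h hc.le⟩
  have h1 := PosSemidef.real_smul h (inv_nonneg.2 hc.le)
  rwa [smul_smul, ← Complex.ofReal_mul, inv_mul_cancel₀ hc.ne', Complex.ofReal_one, one_smul] at h1

/-- The constraint on letter `x` is that of the radius multiplied by `p x`. It is therefore implied
by the latter for any `p`, and equivalent to it for the uniform distribution. -/
theorem renyiCapacity_top_eq_divergenceRadius (t : Family) (N : X → DensityMatrix B) :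
    renyiCapacity t ⊤ N = divergenceRadius t ⊤ N := by
  have key : ∀ (p : stdSimplex ℝ X) (σ : DensityMatrix B) (r : ℝ),
      renyiDiv t ⊤ (cqState p N) (inputState p ⊗ₖ σ.1) ≤ r ↔
      ∀ x, ((p.1 x : ℂ) • (((Real.exp r : ℝ) : ℂ) • σ.1 - (N x).1)).PosSemidef := by
    intro p σ r
    rw [inputState, diagonal_kronecker_eq, renyiDiv_top_cqState_le_iff t p p.1 p.2.1]
    refine forall_congr' fun x => ?_
    rw [smul_sub, smul_smul, mul_comm (Real.exp r), Complex.ofReal_mul]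
  apply le_antisymm
  · refine iSup_le fun p => iInf_mono fun σ => ereal_le_of_forall_real fun r hr => ?_
    rw [iSup_renyiDiv_top_le_iff] at hr
    rw [key]
    exact fun x => PosSemidef.real_smul (hr x) (p.2.1 x)
  · refine le_trans (iInf_mono fun σ => ereal_le_of_forall_real fun r hr => ?_)
      (le_iSup (fun p => renyiInfo t ⊤ p N) (uniformDist X))
    rw [key] at hr
    rw [iSup_renyiDiv_top_le_iff]
    have hpos : (0 : ℝ) < (Fintype.card X : ℝ)⁻¹ := inv_pos.2 (Nat.cast_pos.2 Fintype.card_pos)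
    exact fun x => (posSemidef_smul_iff hpos _).1 (hr x)

theorem arimotoCapacity_top_eq_divergenceRadius (t : Family) (N : X → DensityMatrix B) :
    arimotoCapacity t ⊤ N = divergenceRadius t ⊤ N := by
  have key : ∀ (p : stdSimplex ℝ X) (σ : DensityMatrix B) (r : ℝ),
      ((renyiEntropy ⊤ p.1 : ℝ) : EReal) +
        renyiDiv t ⊤ (cqState p N) ((1 : Matrix X X ℂ) ⊗ₖ σ.1) ≤ r ↔
      ∀ x, ((((Real.exp r * ⨆ y, p.1 y : ℝ)) : ℂ) • σ.1 - (p.1 x : ℂ) • (N x).1).PosSemidef := by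
    intro p σ r
    have hmax : 0 < ⨆ y, p.1 y := by
      obtain ⟨x, hx⟩ : ∃ x, p.1 x ≠ 0 := by
        by_contra! h
        have h3 := p.2.2
        simp [h] at h3
      exact ((p.2.1 x).lt_of_ne' hx).trans_le (le_ciSup (Finite.bddAbove_range p.1) x)
    rw [coe_add_le_coe_iff, one_kronecker_eq,
      renyiDiv_top_cqState_le_iff t p (fun _ => 1) (fun _ => zero_le_one)]
    simp only [renyiEntropy, ENNReal.top_ne_zero, ENNReal.top_ne_one, if_false, if_true,
      sub_neg_eq_add, Real.exp_add, Real.exp_log hmax, mul_one]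
  simp only [arimotoCapacity, arimotoInfo_eq]
  apply le_antisymm
  · refine iSup_le fun p => iInf_mono fun σ => ereal_le_of_forall_real fun r hr => ?_
    rw [iSup_renyiDiv_top_le_iff] at hr
    rw [key]
    intro x
    have h1 : p.1 x ≤ ⨆ y, p.1 y := le_ciSup (Finite.bddAbove_range p.1) x
    -- With `m = max p`: `e^r m σ - p_x ρ_x = p_x (e^r σ - ρ_x) + e^r (m - p_x) σ`.
    have h2 := (PosSemidef.real_smul (hr x) (p.2.1 x)).add (PosSemidef.real_smul σ.2.1
      (mul_nonneg (Real.exp_pos r).le (sub_nonneg.2 h1)))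
    convert h2 using 1
    rw [smul_sub, smul_smul, sub_add_eq_add_sub, ← add_smul]
    congr 2
    push_cast
    ring
  · refine le_trans (iInf_mono fun σ => ereal_le_of_forall_real fun r hr => ?_)
      (le_iSup (fun p : stdSimplex ℝ X => ⨅ σ : DensityMatrix B,
        ((renyiEntropy ⊤ p.1 : ℝ) : EReal) +
          renyiDiv t ⊤ (cqState p N) ((1 : Matrix X X ℂ) ⊗ₖ σ.1)) (uniformDist X))
    rw [key] at hr
    rw [iSup_renyiDiv_top_le_iff]
    have hpos : (0 : ℝ) < (Fintype.card X : ℝ)⁻¹ := inv_pos.2 (Nat.cast_pos.2 Fintype.card_pos)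
    intro x
    rw [← posSemidef_smul_iff hpos]
    convert hr x using 1
    simp only [uniformDist, ciSup_const]
    rw [smul_sub, smul_smul, mul_comm (Real.exp r), Complex.ofReal_mul]

end MaxCapacity

/-! ### Classical Rényi divergences as `f`-divergences. -/

section Kernel

/-- Joint subadditivity of the perspective of a convex function. -/
lemma perspective_sum_le {ι : Type*} [Fintype ι] {f : ℝ → ℝ} (hf : ConvexOn ℝ (Set.Ici 0) f)
    {P Q : ι → ℝ} (hP : ∀ i, 0 ≤ P i) (hQ : ∀ i, 0 ≤ Q i)
    (h : (∀ i, Q i = 0 → P i = 0) ∨ AntitoneOn f (Set.Ici 0)) :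
    (∑ i, Q i) * f ((∑ i, P i) / ∑ i, Q i) ≤ ∑ i, Q i * f (P i / Q i) := by
  rcases (Finset.sum_nonneg fun i _ => hQ i).eq_or_lt with h0 | h0
  · have h1 : ∀ i, Q i = 0 := fun i =>
      (Finset.sum_eq_zero_iff_of_nonneg fun i _ => hQ i).1 h0.symm i (Finset.mem_univ i)
    simp [h1]
  have hw : ∑ i, Q i / ∑ j, Q j = 1 := by rw [← Finset.sum_div, div_self h0.ne']
  have hJ := hf.map_sum_le (t := Finset.univ) (w := fun i => Q i / ∑ j, Q j)
    (p := fun i => P i / Q i) (fun i _ => div_nonneg (hQ i) h0.le) hw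
    (fun i _ => div_nonneg (hP i) (hQ i))
  simp only [smul_eq_mul] at hJ
  -- Jensen's average drops the mass of `P` where `Q` vanishes. Either there is none, or
  -- antitonicity of `f` makes the loss go in the right direction.
  have hterm : ∀ i, Q i / (∑ j, Q j) * (P i / Q i) ≤ P i / ∑ j, Q j := fun i => by
    by_cases hi : Q i = 0
    · rw [hi]; simpa using div_nonneg (hP i) h0.le
    · apply le_of_eq; field_simp
  have hmono : f ((∑ i, P i) / ∑ i, Q i) ≤ f (∑ i, Q i / (∑ j, Q j) * (P i / Q i)) := by
    rcases h with h | h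
    · apply le_of_eq
      congr 1
      rw [Finset.sum_div]
      refine Finset.sum_congr rfl fun i _ => ?_
      by_cases hi : Q i = 0
      · simp [hi, h i hi]
      · field_simp
    · refine h ?_ (div_nonneg (Finset.sum_nonneg fun i _ => hP i) h0.le) ?_
      · exact Finset.sum_nonneg fun i _ =>
          mul_nonneg (div_nonneg (hQ i) h0.le) (div_nonneg (hP i) (hQ i))
      · rw [Finset.sum_div]
        exact Finset.sum_le_sum fun i _ => hterm i
  calc (∑ i, Q i) * f ((∑ i, P i) / ∑ i, Q i)
      ≤ (∑ i, Q i) * ∑ i, Q i / (∑ j, Q j) * f (P i / Q i) :=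
        mul_le_mul_of_nonneg_left (hmono.trans hJ) h0.le
    _ = ∑ i, Q i * f (P i / Q i) := by
        rw [Finset.mul_sum]
        refine Finset.sum_congr rfl fun i _ => ?_
        field_simp

/-- The convex function that generates the classical Rényi divergence of order `a` as an
`f`-divergence. -/
def renyiKernel (a x : ℝ) : ℝ :=
  if a = 0 then (if x = 0 then 0 else -1)
  else if a = 1 then x * Real.log x
  else if a < 1 then -x ^ a
  else x ^ a

lemma renyiKernel_zero (a : ℝ) : renyiKernel a 0 = 0 := by
  unfold renyiKernel
  split_ifs <;> simp_all [Real.zero_rpow]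

lemma renyiKernel_convexOn {a : ℝ} (ha : 0 ≤ a) : ConvexOn ℝ (Set.Ici 0) (renyiKernel a) := by
  by_cases h0 : a = 0
  · rw [convexOn_iff_forall_pos]
    refine ⟨convex_Ici 0, fun x hx y hy s t hs ht hst => ?_⟩
    simp only [renyiKernel, h0, if_true, smul_eq_mul]
    have hx' : (0 : ℝ) ≤ x := hx
    have hy' : (0 : ℝ) ≤ y := hy
    by_cases hxy : s * x + t * y = 0
    · have h1 : s * x = 0 := by nlinarith [mul_nonneg hs.le hx', mul_nonneg ht.le hy']
      have h2 : t * y = 0 := by nlinarith [mul_nonneg hs.le hx', mul_nonneg ht.le hy']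
      have h3 : x = 0 := (mul_eq_zero.1 h1).resolve_left hs.ne'
      have h4 : y = 0 := (mul_eq_zero.1 h2).resolve_left ht.ne'
      simp [h3, h4]
    · rw [if_neg hxy]
      split_ifs <;> linarith
  by_cases h1 : a = 1
  · have : renyiKernel a = fun x => x * Real.log x := by
      ext x; simp [renyiKernel, h1]
    rw [this]
    exact Real.convexOn_mul_log
  by_cases hlt : a < 1
  · have : renyiKernel a = -fun x : ℝ => x ^ a := by
      ext x; simp [renyiKernel, h0, h1, hlt]
    rw [this]
    exact (Real.concaveOn_rpow ha hlt.le).neg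
  · have : renyiKernel a = fun x : ℝ => x ^ a := by
      ext x; simp [renyiKernel, h0, h1, hlt]
    rw [this]
    exact convexOn_rpow (not_lt.1 hlt)

/-- Below order one, monotonicity replaces absolute continuity in `perspective_sum_le`. -/
lemma renyiKernel_antitoneOn {a : ℝ} (ha : 0 ≤ a) (h1 : a < 1) :
    AntitoneOn (renyiKernel a) (Set.Ici 0) := by
  intro x hx y hy hxy
  have hx' : (0 : ℝ) ≤ x := hx
  by_cases h0 : a = 0
  · simp only [renyiKernel, h0, if_true]
    split_ifs with hy0 hx0
    · rfl
    · exact absurd (le_antisymm (hxy.trans hy0.le) hx') hx0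
    · norm_num
    · rfl
  · simp only [renyiKernel, h0, h1.ne, h1, if_true, if_false]
    exact neg_le_neg (Real.rpow_le_rpow hx' hxy ha)

lemma mul_renyiKernel_div {a : ℝ} (h0 : a ≠ 0) (h1 : a ≠ 1) {x y : ℝ} (hx : 0 ≤ x) (hy : 0 ≤ y)
    (hxy : a < 1 ∨ (y = 0 → x = 0)) :
    y * renyiKernel a (x / y) =
      if a < 1 then -(x ^ a * y ^ (1 - a)) else x ^ a * y ^ (1 - a) := by
  have key : y * (x / y) ^ a = x ^ a * y ^ (1 - a) := by
    rcases hy.eq_or_lt with rfl | hy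
    · rcases hxy with h | h
      · rw [Real.zero_rpow (by linarith)]; simp
      · rw [h rfl, Real.zero_rpow h0]; simp
    · rw [Real.div_rpow hx hy.le, Real.rpow_sub hy, Real.rpow_one]
      ring
  simp only [renyiKernel, h0, h1, if_false]
  split_ifs
  · rw [mul_neg, key]
  · exact key

/-- Division by zero makes a term with `Q z = 0` vanish. This is the correct limit for orders below
one; from order one on, absolute continuity must be demanded separately. -/
lemma classicalRenyiDiv_le_iff {α : ℝ≥0∞} (hα : α ≠ ⊤) {Z : Type*} [Fintype Z] {P Q : Z → ℝ}
    (hP : ∀ z, 0 ≤ P z) (hQ : ∀ z, 0 ≤ Q z) (r : ℝ) :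
    classicalRenyiDiv α P Q ≤ r ↔ (1 ≤ α.toReal → ∀ z, Q z = 0 → P z = 0) ∧
      ∑ z, Q z * renyiKernel α.toReal (P z / Q z) ≤ levelMap α.toReal r := by
  by_cases h0 : α = 0
  · subst h0
    have h1 : ∑ z, Q z * renyiKernel 0 (P z / Q z) = -∑ z, if P z = 0 then 0 else Q z := by
      rw [← Finset.sum_neg_distrib]
      refine Finset.sum_congr rfl fun z _ => ?_
      by_cases hq : Q z = 0 <;> by_cases hp : P z = 0 <;> simp [renyiKernel, hp, hq]
    have h2 := inv_mul_log_le_iff_of_lt_one (zero_lt_one' ℝ) (∑ z, if P z = 0 then 0 else Q z) r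
    have h3 : (((0 - 1 : ℝ)⁻¹ : ℝ) : EReal) = -1 := by norm_num
    rw [h3, neg_mul, one_mul] at h2
    simp only [classicalRenyiDiv, if_true, ENNReal.toReal_zero, levelMap, zero_ne_one, if_false,
      zero_lt_one, h1, h2]
    refine ⟨fun h => ⟨fun h' => absurd h' (by norm_num), h⟩, fun h => h.2⟩
  by_cases h1 : α = 1
  · subst h1
    simp only [classicalRenyiDiv, one_ne_zero, if_false, if_true, ENNReal.toReal_one, levelMap,
      le_refl, true_imp_iff]
    by_cases hac : ∀ z, Q z = 0 → P z = 0
    · rw [if_pos hac, EReal.coe_le_coe_iff]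
      have : ∑ z, Q z * renyiKernel 1 (P z / Q z) = ∑ z, P z * Real.log (P z / Q z) := by
        refine Finset.sum_congr rfl fun z _ => ?_
        by_cases hq : Q z = 0
        · simp [hq, hac z hq]
        · simp only [renyiKernel, one_ne_zero, if_false, if_true]
          field_simp
      rw [this]
      exact (and_iff_right hac).symm
    · rw [if_neg hac]
      simp [hac]
  have h0' : α.toReal ≠ 0 := ENNReal.toReal_ne_zero.2 ⟨h0, hα⟩
  have h1' : α.toReal ≠ 1 := fun h => h1 (by
    rw [← ENNReal.ofReal_toReal hα, h, ENNReal.ofReal_one])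
  have hlt : α < 1 ↔ α.toReal < 1 := by
    rw [← ENNReal.toReal_one, ENNReal.toReal_lt_toReal hα ENNReal.one_ne_top]
  simp only [classicalRenyiDiv, h0, h1, hα, if_false, levelMap, h1', hlt]
  by_cases hl : α.toReal < 1
  · have : ∑ z, Q z * renyiKernel α.toReal (P z / Q z) =
        -∑ z, P z ^ α.toReal * Q z ^ (1 - α.toReal) := by
      rw [← Finset.sum_neg_distrib]
      refine Finset.sum_congr rfl fun z _ => ?_
      rw [mul_renyiKernel_div h0' h1' (hP z) (hQ z) (Or.inl hl), if_pos hl]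
    rw [if_pos (Or.inl hl), if_pos hl, this, inv_mul_log_le_iff_of_lt_one hl]
    exact ⟨fun h => ⟨fun h' => absurd h' (not_le.2 hl), h⟩, fun h => h.2⟩
  · have hl' : 1 ≤ α.toReal := not_lt.1 hl
    by_cases hac : ∀ z, Q z = 0 → P z = 0
    · have : ∑ z, Q z * renyiKernel α.toReal (P z / Q z) =
          ∑ z, P z ^ α.toReal * Q z ^ (1 - α.toReal) := by
        refine Finset.sum_congr rfl fun z _ => ?_
        rw [mul_renyiKernel_div h0' h1' (hP z) (hQ z) (Or.inr (hac z)), if_neg hl]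
      rw [if_pos (Or.inr hac), if_neg hl, this,
        inv_mul_log_le_iff_of_one_lt (lt_of_le_of_ne hl' (Ne.symm h1'))]
      exact ⟨fun h => ⟨fun _ => hac, h⟩, fun h => h.2⟩
    · rw [if_neg (by simp only [hl, hac, or_self, not_false_eq_true])]
      simp [hac, hl']

/-- If all choices of one term from each of finitely many families have bounded weighted sums, then
the families have upper bounds with the same bound on their weighted sum. -/
lemma exists_upper_bounds {X T : Type*} [Fintype X] [Nonempty T] {c : X → ℝ} (hc : ∀ x, 0 ≤ c x)
    (v : X → T → ℝ) {V : ℝ} (h : ∀ e : X → T, ∑ x, c x * v x (e x) ≤ V) :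
    ∃ u : X → ℝ, (∀ x, c x ≠ 0 → ∀ e, v x e ≤ u x) ∧ ∑ x, c x * u x ≤ V := by
  classical
  obtain ⟨e₀⟩ := ‹Nonempty T›
  have hbdd : ∀ x, c x ≠ 0 → BddAbove (Set.range (v x)) := by
    intro x hx
    have hcx : 0 < c x := (hc x).lt_of_ne' hx
    refine ⟨(V - ∑ y ∈ Finset.univ.erase x, c y * v y e₀) / c x, ?_⟩
    rintro _ ⟨e, rfl⟩
    -- Varying a single choice, with the others frozen at `e₀`, bounds one family at a time.
    have h1 := h (Function.update (fun _ => e₀) x e)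
    rw [← Finset.add_sum_erase _ _ (Finset.mem_univ x), Function.update_self,
      Finset.sum_congr rfl fun y hy => by
        rw [Function.update_of_ne (Finset.ne_of_mem_erase hy)]] at h1
    rw [le_div_iff₀ hcx]
    linarith
  have : Nonempty T := ⟨e₀⟩
  refine ⟨fun x => ⨆ e, v x e, fun x hx e => le_ciSup (hbdd x hx) e, ?_⟩
  have hε : ∀ ε > 0, ∑ x, c x * (⨆ e, v x e) ≤ V + ε * ∑ x, c x := by
    intro ε hε
    have hex : ∀ x, ∃ e, c x ≠ 0 → (⨆ e, v x e) - ε < v x e := fun x => by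
      obtain ⟨e, he⟩ := exists_lt_of_lt_ciSup (sub_lt_self (⨆ e, v x e) hε)
      exact ⟨e, fun _ => he⟩
    choose e he using hex
    have h1 := h e
    have h2 : ∑ x, c x * (⨆ e, v x e) ≤ ∑ x, (c x * v x (e x) + ε * c x) := by
      refine Finset.sum_le_sum fun x _ => ?_
      by_cases hx : c x = 0
      · simp [hx]
      · nlinarith [he x hx, (hc x)]
    rw [Finset.sum_add_distrib, ← Finset.mul_sum] at h2
    linarith
  have hC : 0 ≤ ∑ x, c x := Finset.sum_nonneg fun x _ => hc x
  -- The summand `1` guards against `∑ c = 0`.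
  refine le_of_forall_pos_le_add fun δ hδ => (hε (δ / (1 + ∑ x, c x)) (by positivity)).trans ?_
  have : δ / (1 + ∑ x, c x) * ∑ x, c x ≤ δ := by
    rw [div_mul_eq_mul_div, div_le_iff₀ (by positivity)]
    nlinarith
  linarith

end Kernel

/-! ### Measurements and the measured trace functional. -/

section Measurements

variable {n Z : Type*} [Fintype n] [DecidableEq n] [Fintype Z]

/-- The outcome probabilities of a measurement. -/
def POVM.prob (E : POVM n Z) (ρ : Matrix n n ℂ) (z : Z) : ℝ := (ρ * E.effect z).trace.re

lemma POVM.prob_nonneg (E : POVM n Z) {ρ : Matrix n n ℂ} (hρ : ρ.PosSemidef) (z : Z) :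
    0 ≤ E.prob ρ z := trace_mul_re_nonneg hρ (E.posSemidef z)

lemma POVM.prob_add (E : POVM n Z) (ρ σ : Matrix n n ℂ) (z : Z) :
    E.prob (ρ + σ) z = E.prob ρ z + E.prob σ z := by
  simp [POVM.prob, add_mul]

lemma POVM.prob_smul (E : POVM n Z) (c : ℝ) (ρ : Matrix n n ℂ) (z : Z) :
    E.prob ((c : ℂ) • ρ) z = c * E.prob ρ z := by
  simp [POVM.prob]

lemma POVM.sum_prob (E : POVM n Z) (ρ : Matrix n n ℂ) : ∑ z, E.prob ρ z = ρ.trace.re := by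
  simp only [POVM.prob]
  rw [← Complex.re_sum, ← Matrix.trace_sum, ← Finset.mul_sum, E.sum_eq_one, mul_one]

/-- The classical trace functional bound `u` holds for the outcome distributions of `E`. -/
def POVM.Bounds (E : POVM n Z) (a : ℝ) (ρ σ : Matrix n n ℂ) (u : ℝ) : Prop :=
  (1 ≤ a → ∀ z, E.prob σ z = 0 → E.prob ρ z = 0) ∧
    ∑ z, E.prob σ z * renyiKernel a (E.prob ρ z / E.prob σ z) ≤ u

/-- The epigraph of the measured trace functional of order `a`. -/
def measuredEpi (a : ℝ) (ρ σ : Matrix n n ℂ) (u : ℝ) : Prop :=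
  ∀ (k : ℕ) (E : POVM n (Fin k)), E.Bounds a ρ σ u

lemma measuredRenyiDiv_le_iff {α : ℝ≥0∞} (hα : α ≠ ⊤) {ρ σ : Matrix n n ℂ} (hρ : ρ.PosSemidef)
    (hσ : σ.PosSemidef) (r : ℝ) :
    measuredRenyiDiv α ρ σ ≤ r ↔ measuredEpi α.toReal ρ σ (levelMap α.toReal r) := by
  simp only [measuredRenyiDiv, iSup_le_iff]
  refine forall_congr' fun k => forall_congr' fun E => ?_
  exact classicalRenyiDiv_le_iff hα (E.prob_nonneg hρ) (E.prob_nonneg hσ) r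

lemma measuredEpi.mono {a : ℝ} {ρ σ : Matrix n n ℂ} {u v : ℝ} (h : measuredEpi a ρ σ u)
    (huv : u ≤ v) : measuredEpi a ρ σ v :=
  fun k E => ⟨(h k E).1, (h k E).2.trans huv⟩

/-- Relabelling of the outcomes of a measurement. -/
def POVM.relabel {W : Type*} [Fintype W] (E : POVM n Z) (e : W ≃ Z) : POVM n W where
  effect := fun w => E.effect (e w)
  posSemidef := fun w => E.posSemidef (e w)
  sum_eq_one := by rw [e.sum_comp, E.sum_eq_one]

/-- Allows outcomes in any finite type, such as pairs of a letter and a conditional outcome. -/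
lemma measuredEpi.bounds {a : ℝ} {ρ σ : Matrix n n ℂ} {u : ℝ} (h : measuredEpi a ρ σ u)
    (E : POVM n Z) : E.Bounds a ρ σ u := by
  obtain ⟨h1, h2⟩ := h _ (E.relabel (Fintype.equivFin Z).symm)
  refine ⟨fun ha z hz => ?_, ?_⟩
  · have := h1 ha (Fintype.equivFin Z z)
    simp only [POVM.prob, POVM.relabel, Equiv.symm_apply_apply] at this
    exact this hz
  · refine le_trans (le_of_eq ?_) h2
    exact ((Fintype.equivFin Z).symm.sum_comp fun z =>
      E.prob σ z * renyiKernel a (E.prob ρ z / E.prob σ z)).symm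

/-- The trivial measurement. -/
def trivialPOVM (n : Type*) [Fintype n] [DecidableEq n] : POVM n (Fin 1) where
  effect := fun _ => 1
  posSemidef := fun _ => .one
  sum_eq_one := by simp

/-- The trivial measurement provides the uniform lower bound required by the minimax theorem. -/
lemma measuredEpi.renyiKernel_one_le {a : ℝ} {ρ σ : Matrix n n ℂ} {u : ℝ}
    (h : measuredEpi a ρ σ u) (hρ : ρ.trace = 1) (hσ : σ.trace = 1) : renyiKernel a 1 ≤ u := by
  have h1 := (h 1 (trivialPOVM n)).2
  simpa [POVM.prob, trivialPOVM, hρ, hσ] using h1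

lemma measuredEpi.convex {a : ℝ} (ha : 0 ≤ a) {ρ σ₁ σ₂ : Matrix n n ℂ} (hρ : ρ.PosSemidef)
    (h₁ : σ₁.PosSemidef) (h₂ : σ₂.PosSemidef) {u₁ u₂ s t : ℝ} (hs : 0 < s) (ht : 0 < t)
    (hst : s + t = 1) (hE₁ : measuredEpi a ρ σ₁ u₁) (hE₂ : measuredEpi a ρ σ₂ u₂) :
    measuredEpi a ρ ((s : ℂ) • σ₁ + (t : ℂ) • σ₂) (s * u₁ + t * u₂) := by
  intro k E
  obtain ⟨hac₁, hle₁⟩ := hE₁ k E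
  obtain ⟨hac₂, hle₂⟩ := hE₂ k E
  have hprob : ∀ z, E.prob ((s : ℂ) • σ₁ + (t : ℂ) • σ₂) z =
      s * E.prob σ₁ z + t * E.prob σ₂ z := fun z => by
    rw [POVM.prob_add, POVM.prob_smul, POVM.prob_smul]
  have hn₁ := E.prob_nonneg h₁
  have hn₂ := E.prob_nonneg h₂
  have hnρ := E.prob_nonneg hρ
  refine ⟨fun h z hz => ?_, ?_⟩
  · rw [hprob] at hz
    refine hac₁ h z ?_
    have h1 := mul_nonneg hs.le (hn₁ z)
    have h2 := mul_nonneg ht.le (hn₂ z)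
    exact (mul_eq_zero.1 (by linarith)).resolve_left hs.ne'
  · calc ∑ z, E.prob ((s : ℂ) • σ₁ + (t : ℂ) • σ₂) z *
          renyiKernel a (E.prob ρ z / E.prob ((s : ℂ) • σ₁ + (t : ℂ) • σ₂) z)
        ≤ ∑ z, (s * (E.prob σ₁ z * renyiKernel a (E.prob ρ z / E.prob σ₁ z)) +
          t * (E.prob σ₂ z * renyiKernel a (E.prob ρ z / E.prob σ₂ z))) := by
          refine Finset.sum_le_sum fun z _ => ?_
          -- Outcome probabilities are linear in the state, so it suffices to split `ρ = s ρ + t ρ`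
          -- alongside the mixture of `σ₁` and `σ₂`.
          have := perspective_sum_le (renyiKernel_convexOn ha)
            (P := ![s * E.prob ρ z, t * E.prob ρ z])
            (Q := ![s * E.prob σ₁ z, t * E.prob σ₂ z])
            (by intro i; fin_cases i
                · exact mul_nonneg hs.le (hnρ z)
                · exact mul_nonneg ht.le (hnρ z))
            (by intro i; fin_cases i
                · exact mul_nonneg hs.le (hn₁ z)
                · exact mul_nonneg ht.le (hn₂ z))
            (by
              rcases lt_or_ge a 1 with h | h
              · exact Or.inr (renyiKernel_antitoneOn ha h)
              · refine Or.inl fun i => ?_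
                fin_cases i
                · intro hz
                  have hz' : s * E.prob σ₁ z = 0 := hz
                  change s * E.prob ρ z = 0
                  rw [hac₁ h z ((mul_eq_zero.1 hz').resolve_left hs.ne'), mul_zero]
                · intro hz
                  have hz' : t * E.prob σ₂ z = 0 := hz
                  change t * E.prob ρ z = 0
                  rw [hac₂ h z ((mul_eq_zero.1 hz').resolve_left ht.ne'), mul_zero])
          simp only [Fin.sum_univ_two, Matrix.cons_val_zero, Matrix.cons_val_one,
            mul_div_mul_left _ _ hs.ne', mul_div_mul_left _ _ ht.ne', ← add_mul, hst, one_mul,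
            mul_assoc] at this
          rw [hprob]
          exact this
      _ ≤ s * u₁ + t * u₂ := by
          rw [Finset.sum_add_distrib, ← Finset.mul_sum, ← Finset.mul_sum]
          exact add_le_add (mul_le_mul_of_nonneg_left hle₁ hs.le)
            (mul_le_mul_of_nonneg_left hle₂ ht.le)

end Measurements

/-! ### Measuring classical-quantum states. -/

section BlockMeasurements

variable {X B Z : Type*} [Fintype X] [DecidableEq X] [Fintype B] [DecidableEq B] [Fintype Z]

/-- The measurement that `E` performs on the block `x`. -/
def POVM.onBlock (E : POVM (X × B) Z) (x : X) : POVM B Z where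
  effect := fun z => block x (E.effect z)
  posSemidef := fun z => (E.posSemidef z).submatrix _
  sum_eq_one := by
    ext b c
    have h := congrFun (congrFun E.sum_eq_one (x, b)) (x, c)
    simpa [block, Matrix.sum_apply, Matrix.one_apply] using h

lemma POVM.prob_blockSum (E : POVM (X × B) Z) (w : X → ℝ) (M : X → Matrix B B ℂ) (z : Z) :
    E.prob (blockSum fun x => (w x : ℂ) • M x) z = ∑ x, w x * (E.onBlock x).prob (M x) z := by
  rw [POVM.prob, trace_blockSum_mul, Complex.re_sum]
  refine Finset.sum_congr rfl fun x _ => ?_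
  rw [← POVM.prob_smul]
  rfl

/-- The measurement of `x` followed by the measurement `E x`. -/
def conditionalPOVM (k : X → ℕ) (E : ∀ x, POVM B (Fin (k x))) : POVM (X × B) (Σ x, Fin (k x)) where
  effect := fun z => blockSum (Pi.single z.1 ((E z.1).effect z.2))
  posSemidef := fun z => by
    rw [posSemidef_blockSum_iff]
    intro y
    by_cases h : y = z.1
    · rw [h, Pi.single_eq_same]; exact (E z.1).posSemidef z.2
    · rw [Pi.single_eq_of_ne h]; exact .zero
  sum_eq_one := by
    rw [Fintype.sum_sigma, ← blockSum_one]
    ext ⟨y, b⟩ ⟨y', c⟩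
    simp only [Matrix.sum_apply, blockSum, Matrix.of_apply]
    by_cases h : y = y'
    · subst h
      simp only [if_true]
      rw [Finset.sum_eq_single y (fun x _ hx => by simp [Pi.single_eq_of_ne hx.symm]) (by simp)]
      simp only [Pi.single_eq_same]
      rw [← Matrix.sum_apply, (E y).sum_eq_one]
    · simp [h]

lemma prob_conditionalPOVM (k : X → ℕ) (E : ∀ x, POVM B (Fin (k x))) (w : X → ℝ)
    (M : X → Matrix B B ℂ) (x : X) (j : Fin (k x)) :
    (conditionalPOVM k E).prob (blockSum fun x => (w x : ℂ) • M x) ⟨x, j⟩ =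
      w x * (E x).prob (M x) j := by
  rw [POVM.prob_blockSum, Finset.sum_eq_single x]
  · congr 1
    simp [POVM.prob, POVM.onBlock, conditionalPOVM, block_blockSum]
  · intro y _ hy
    simp [POVM.prob, POVM.onBlock, conditionalPOVM, block_blockSum, Pi.single_eq_of_ne hy]
  · simp

/-- The measured trace functional of a classical-quantum state is a weighted sum of the measured
trace functionals of its blocks. -/
theorem measuredEpi_cqState_iff {a : ℝ} (ha : 0 ≤ a) (p : stdSimplex ℝ X)
    (N : X → DensityMatrix B) (σ : DensityMatrix B) {w c d : X → ℝ} (hw : ∀ x, 0 ≤ w x)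
    (hc : ∀ x, 0 ≤ c x) (hp0 : ∀ x, p.1 x = 0 → c x = 0 ∧ d x = 0)
    (hp : ∀ x, p.1 x ≠ 0 → c x ≠ 0 ∧ w x ≠ 0)
    (hker : ∀ x, p.1 x ≠ 0 → ∀ P Q : ℝ, 0 ≤ P → 0 ≤ Q → (1 ≤ a → Q = 0 → P = 0) →
      w x * Q * renyiKernel a (p.1 x * P / (w x * Q)) =
        c x * (Q * renyiKernel a (P / Q)) + d x * P) (v : ℝ) :
    measuredEpi a (cqState p N) (blockSum fun x => (w x : ℂ) • σ.1) v ↔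
      ∃ u : X → ℝ, (∀ x, p.1 x ≠ 0 → measuredEpi a (N x).1 σ.1 (u x)) ∧
        ∑ x, c x * u x + ∑ x, d x ≤ v := by
  rw [cqState_eq]
  have hker' : ∀ x, ∀ P Q : ℝ, 0 ≤ P → 0 ≤ Q → (p.1 x ≠ 0 → 1 ≤ a → Q = 0 → P = 0) →
      w x * Q * renyiKernel a (p.1 x * P / (w x * Q)) =
        c x * (Q * renyiKernel a (P / Q)) + d x * P := by
    intro x P Q hP hQ hac
    by_cases hx : p.1 x = 0
    · simp [hx, renyiKernel_zero, hp0 x hx]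
    · exact hker x hx P Q hP hQ (hac hx)
  have hsumP : ∀ {W : Type _} [Fintype W] (E : POVM B W) x, ∑ z, E.prob (N x).1 z = 1 :=
    fun E x => by rw [E.sum_prob, (N x).2.2, Complex.one_re]
  constructor
  · intro h
    have hac : ∀ x, p.1 x ≠ 0 → ∀ k (E : POVM B (Fin k)), 1 ≤ a → ∀ z,
        E.prob σ.1 z = 0 → E.prob (N x).1 z = 0 := by
      intro x hx k E h1 z hz
      have h2 := (h.bounds (conditionalPOVM (fun _ => k) (fun _ => E))).1 h1 ⟨x, z⟩
      rw [prob_conditionalPOVM, prob_conditionalPOVM, hz, mul_zero] at h2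
      exact (mul_eq_zero.1 (h2 rfl)).resolve_left hx
    have : Nonempty (Σ k, POVM B (Fin k)) := ⟨⟨1, trivialPOVM B⟩⟩
    -- Measuring the letter first lets the measurement on `B` be chosen independently for each
    -- letter, which separates the joint bound into letterwise bounds.
    obtain ⟨u, hu, hle⟩ := exists_upper_bounds hc
      (fun x (e : Σ k, POVM B (Fin k)) => ∑ z, e.2.prob σ.1 z *
        renyiKernel a (e.2.prob (N x).1 z / e.2.prob σ.1 z)) (V := v - ∑ x, d x) (by
      intro e
      have h1 := (h.bounds (conditionalPOVM (fun x => (e x).1) (fun x => (e x).2))).2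
      simp only [Fintype.sum_sigma, prob_conditionalPOVM] at h1
      have h2 : ∀ x, (∑ j, w x * (e x).2.prob σ.1 j *
          renyiKernel a (p.1 x * (e x).2.prob (N x).1 j / (w x * (e x).2.prob σ.1 j))) =
          c x * (∑ z, (e x).2.prob σ.1 z *
            renyiKernel a ((e x).2.prob (N x).1 z / (e x).2.prob σ.1 z)) + d x := by
        intro x
        rw [Finset.sum_congr rfl fun j _ => hker' x _ _ ((e x).2.prob_nonneg (N x).2.1 j)
          ((e x).2.prob_nonneg σ.2.1 j) fun hx h1 => hac x hx _ (e x).2 h1 j,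
          Finset.sum_add_distrib, ← Finset.mul_sum, ← Finset.mul_sum, hsumP, mul_one]
      simp only [h2, Finset.sum_add_distrib] at h1
      linarith)
    exact ⟨u, fun x hx k E => ⟨hac x hx k E, hu x (hp x hx).1 ⟨k, E⟩⟩, by linarith⟩
  · rintro ⟨u, hu, hle⟩ k E
    have hac : ∀ x z, p.1 x ≠ 0 → 1 ≤ a → (E.onBlock x).prob σ.1 z = 0 →
        (E.onBlock x).prob (N x).1 z = 0 := fun x z hx h1 => (hu x hx k (E.onBlock x)).1 h1 z
    have hnσ : ∀ x z, 0 ≤ w x * (E.onBlock x).prob σ.1 z := fun x z =>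
      mul_nonneg (hw x) ((E.onBlock x).prob_nonneg σ.2.1 z)
    have hnρ : ∀ x z, 0 ≤ p.1 x * (E.onBlock x).prob (N x).1 z := fun x z =>
      mul_nonneg (p.2.1 x) ((E.onBlock x).prob_nonneg (N x).2.1 z)
    have hac' : 1 ≤ a → ∀ z x, w x * (E.onBlock x).prob σ.1 z = 0 →
        p.1 x * (E.onBlock x).prob (N x).1 z = 0 := by
      intro h1 z x hz
      by_cases hx : p.1 x = 0
      · rw [hx, zero_mul]
      · rw [hac x z hx h1 ((mul_eq_zero.1 hz).resolve_left (hp x hx).2), mul_zero]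
    refine ⟨fun h1 z hz => ?_, ?_⟩
    · rw [POVM.prob_blockSum] at hz ⊢
      refine Finset.sum_eq_zero fun x _ => hac' h1 z x ?_
      exact (Finset.sum_eq_zero_iff_of_nonneg fun x _ => hnσ x z).1 hz x (Finset.mem_univ x)
    · simp only [POVM.prob_blockSum]
      -- On block-diagonal states a joint measurement amounts to measuring each block and forgetting
      -- the letter; forgetting cannot increase the functional.
      calc _ ≤ ∑ z, ∑ x, w x * (E.onBlock x).prob σ.1 z * renyiKernel a
              (p.1 x * (E.onBlock x).prob (N x).1 z / (w x * (E.onBlock x).prob σ.1 z)) := by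
            refine Finset.sum_le_sum fun z _ => ?_
            refine perspective_sum_le (renyiKernel_convexOn ha) (fun x => hnρ x z)
              (fun x => hnσ x z) ?_
            rcases lt_or_ge a 1 with h | h
            · exact Or.inr (renyiKernel_antitoneOn ha h)
            · exact Or.inl (hac' h z)
        _ = ∑ x, (c x * (∑ z, (E.onBlock x).prob σ.1 z * renyiKernel a
              ((E.onBlock x).prob (N x).1 z / (E.onBlock x).prob σ.1 z)) + d x) := by
            rw [Finset.sum_comm]
            refine Finset.sum_congr rfl fun x _ => ?_
            rw [Finset.sum_congr rfl fun z _ => hker' x _ _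
              ((E.onBlock x).prob_nonneg (N x).2.1 z) ((E.onBlock x).prob_nonneg σ.2.1 z)
              (hac x z), Finset.sum_add_distrib, ← Finset.mul_sum, ← Finset.mul_sum, hsumP,
              mul_one]
        _ ≤ ∑ x, (c x * u x + d x) := by
            refine Finset.sum_le_sum fun x _ => ?_
            by_cases hx : p.1 x = 0
            · simp [hp0 x hx]
            · exact add_le_add_left
                (mul_le_mul_of_nonneg_left (hu x hx k (E.onBlock x)).2 (hc x)) _
        _ ≤ v := by rwa [Finset.sum_add_distrib]

end BlockMeasurements

/-- Source of the weights `p ^ a` against `1 ⊗ σ`; at order one the logarithm of the product leaves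
the additive entropy term. -/
lemma mul_renyiKernel_mul_div {a p P Q : ℝ} (h0 : a ≠ 0) (hp : 0 < p) (hP : 0 ≤ P) (hQ : 0 ≤ Q)
    (hac : 1 ≤ a → Q = 0 → P = 0) :
    Q * renyiKernel a (p * P / Q) =
      p ^ a * (Q * renyiKernel a (P / Q)) + (if a = 1 then p * Real.log p else 0) * P := by
  by_cases h1 : a = 1
  · subst h1
    simp only [renyiKernel, one_ne_zero, if_false, if_true, Real.rpow_one]
    rcases hQ.eq_or_lt with rfl | hQ
    · simp [hac le_rfl rfl]
    rcases hP.eq_or_lt with rfl | hP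
    · simp
    rw [mul_div_assoc, Real.log_mul hp.ne' (div_pos hP hQ).ne']
    field_simp
    ring
  · have h2 : a < 1 ∨ (Q = 0 → P = 0) := (lt_or_ge a 1).imp_right hac
    have h3 : a < 1 ∨ (Q = 0 → p * P = 0) := h2.imp_right fun h hq => by rw [h hq, mul_zero]
    rw [mul_renyiKernel_div h0 h1 (mul_nonneg hp.le hP) hQ h3, mul_renyiKernel_div h0 h1 hP hQ h2,
      if_neg h1, Real.mul_rpow hp.le hP]
    split_ifs <;> ring

/-! ### The measured capacities at finite order. -/

section MeasuredCapacity

variable {X B : Type*} [Fintype X] [DecidableEq X] [Fintype B] [DecidableEq B]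

lemma posSemidef_blockSum_smul {w : X → ℝ} (hw : ∀ x, 0 ≤ w x) (σ : DensityMatrix B) :
    (blockSum fun x => (w x : ℂ) • σ.1).PosSemidef :=
  (posSemidef_blockSum_iff _).2 fun x => PosSemidef.real_smul σ.2.1 (hw x)

lemma measured_inputState_le_iff {α : ℝ≥0∞} (hα : α ≠ ⊤) (p : stdSimplex ℝ X)
    (N : X → DensityMatrix B) (σ : DensityMatrix B) (r : ℝ) :
    renyiDiv Family.measured α (cqState p N) (inputState p ⊗ₖ σ.1) ≤ r ↔
      ∃ u : X → ℝ, (∀ x, p.1 x ≠ 0 → measuredEpi α.toReal (N x).1 σ.1 (u x)) ∧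
        ∑ x, p.1 x * u x ≤ levelMap α.toReal r := by
  have h := measuredEpi_cqState_iff ENNReal.toReal_nonneg p N σ (a := α.toReal) (w := p.1)
    (c := p.1) (d := 0) p.2.1 p.2.1 (fun x hx => ⟨hx, rfl⟩) (fun x hx => ⟨hx, hx⟩)
    (fun x hx P Q _ _ _ => by
      rw [mul_div_mul_left _ _ hx, Pi.zero_apply, zero_mul, add_zero, mul_assoc])
    (levelMap α.toReal r)
  simp only [Pi.zero_apply, Finset.sum_const_zero, add_zero] at h
  rw [inputState, diagonal_kronecker_eq, ← h]
  exact measuredRenyiDiv_le_iff hα (posSemidef_cqState p N) (posSemidef_blockSum_smul p.2.1 σ) r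

lemma measured_one_le_iff {α : ℝ≥0∞} (h0 : α ≠ 0) (hα : α ≠ ⊤) (p : stdSimplex ℝ X)
    (N : X → DensityMatrix B) (σ : DensityMatrix B) (r : ℝ) :
    renyiDiv Family.measured α (cqState p N) ((1 : Matrix X X ℂ) ⊗ₖ σ.1) ≤ r ↔
      ∃ u : X → ℝ, (∀ x, p.1 x ≠ 0 → measuredEpi α.toReal (N x).1 σ.1 (u x)) ∧
        ∑ x, p.1 x ^ α.toReal * u x + (if α = 1 then ∑ x, p.1 x * Real.log (p.1 x) else 0) ≤
          levelMap α.toReal r := by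
  have ha : α.toReal ≠ 0 := ENNReal.toReal_ne_zero.2 ⟨h0, hα⟩
  have h1 : α.toReal = 1 ↔ α = 1 := ENNReal.toReal_eq_one_iff α
  have h := measuredEpi_cqState_iff ENNReal.toReal_nonneg p N σ (a := α.toReal)
    (w := fun _ => 1) (c := fun x => p.1 x ^ α.toReal)
    (d := fun x => if α.toReal = 1 then p.1 x * Real.log (p.1 x) else 0)
    (fun _ => zero_le_one) (fun x => Real.rpow_nonneg (p.2.1 x) _)
    (fun x hx => ⟨by rw [hx, Real.zero_rpow ha], by simp [hx]⟩)
    (fun x hx => ⟨(Real.rpow_ne_zero (p.2.1 x) ha).2 hx, one_ne_zero⟩)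
    (fun x hx P Q hP hQ hac => by
      rw [one_mul]
      exact mul_renyiKernel_mul_div ha ((p.2.1 x).lt_of_ne' hx) hP hQ hac)
    (levelMap α.toReal r)
  have hd : (∑ x, if α.toReal = 1 then p.1 x * Real.log (p.1 x) else 0) =
      if α = 1 then ∑ x, p.1 x * Real.log (p.1 x) else 0 := by
    simp only [h1]
    split_ifs <;> simp
  rw [hd] at h
  rw [one_kronecker_eq, ← h]
  exact measuredRenyiDiv_le_iff hα (posSemidef_cqState p N)
    (posSemidef_blockSum_smul (fun _ => zero_le_one) σ) r

/-- Convex combinations of density matrices. -/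
def DensityMatrix.mix (σ₁ σ₂ : DensityMatrix B) {s t : ℝ} (hs : 0 < s) (ht : 0 < t)
    (hst : s + t = 1) : DensityMatrix B :=
  ⟨(s : ℂ) • σ₁.1 + (t : ℂ) • σ₂.1,
    (PosSemidef.real_smul σ₁.2.1 hs.le).add (PosSemidef.real_smul σ₂.2.1 ht.le), by
    rw [Matrix.trace_add, Matrix.trace_smul, Matrix.trace_smul, σ₁.2.2, σ₂.2.2, smul_eq_mul,
      smul_eq_mul, mul_one, mul_one]
    exact_mod_cast hst⟩

theorem measured_renyiCapacity_eq_divergenceRadius [Nonempty X] {α : ℝ≥0∞} (hα : α ≠ ⊤)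
    (N : X → DensityMatrix B) :
    renyiCapacity Family.measured α N = divergenceRadius Family.measured α N :=
  iSup_iInf_eq_iInf_iSup_of_epigraph
    (fun x (σ : DensityMatrix B) => renyiDiv Family.measured α (N x).1 σ.1)
    (fun p σ => renyiDiv Family.measured α (cqState p N) (inputState p ⊗ₖ σ.1))
    (levelMap α.toReal) (levelMap_strictMono _)
    (fun x σ u => measuredEpi α.toReal (N x).1 σ.1 u)
    (fun _ _ _ _ h huv => h.mono huv)
    (fun x σ r => measuredRenyiDiv_le_iff hα (N x).2.1 σ.2.1 r)
    (fun p σ r => measured_inputState_le_iff hα p N σ r)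
    (fun σ₁ σ₂ _ _ _ _ hs ht hst h₁ h₂ => ⟨σ₁.mix σ₂ hs ht hst, fun x =>
      measuredEpi.convex ENNReal.toReal_nonneg (N x).2.1 σ₁.2.1 σ₂.2.1 hs ht hst (h₁ x) (h₂ x)⟩)
    (fun _ => renyiKernel α.toReal 1)
    (fun x σ _ h => h.renyiKernel_one_le (N x).2.2 σ.2.2)

theorem measured_arimotoCapacity_eq_renyiCapacity {α : ℝ≥0∞} (h0 : α ≠ 0)
    (hα : α ≠ ⊤) (N : X → DensityMatrix B) :
    arimotoCapacity Family.measured α N = renyiCapacity Family.measured α N :=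
  arimotoCapacity_eq_renyiCapacity_of_epigraph Family.measured h0 hα N
    (fun x σ u => measuredEpi α.toReal (N x).1 σ.1 u)
    (fun p σ r => measured_inputState_le_iff hα p N σ r)
    (fun p σ r => measured_one_le_iff h0 hα p N σ r)

end MeasuredCapacity

/-! ### Spectral calculus and convexity of trace functionals. -/

section SpectralCalculus

variable {n : Type*} [Fintype n] [DecidableEq n]

/-- The spectrum is finite, so the calculus also covers functions discontinuous at zero, such as
negative powers and the logarithm. -/
lemma continuousOn_spectrum (A : Matrix n n ℂ) (f : ℝ → ℝ) : ContinuousOn f (spectrum ℝ A) :=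
  A.finite_real_spectrum.continuousOn f

/-- The squared modulus of the coordinates of a vector in the eigenbasis of a Hermitian matrix. -/
def eigenWeight {A : Matrix n n ℂ} (hA : A.IsHermitian) (v : n → ℂ) (i : n) : ℝ :=
  Complex.normSq ((star (hA.eigenvectorUnitary : Matrix n n ℂ)).mulVec v i)

lemma eigenWeight_nonneg {A : Matrix n n ℂ} (hA : A.IsHermitian) (v : n → ℂ) (i : n) :
    0 ≤ eigenWeight hA v i := Complex.normSq_nonneg _

lemma quadForm_cfc {A : Matrix n n ℂ} (hA : A.IsHermitian) (f : ℝ → ℝ) (v : n → ℂ) :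
    quadForm (cfc f A) v = ∑ i, f (hA.eigenvalues i) * eigenWeight hA v i := by
  rw [hA.cfc_eq, Matrix.IsHermitian.cfc, Unitary.conjStarAlgAut_apply, quadForm,
    ← Matrix.mulVec_mulVec, ← Matrix.mulVec_mulVec, Matrix.dotProduct_mulVec]
  have h : Matrix.vecMul (star v) (hA.eigenvectorUnitary : Matrix n n ℂ) =
      star ((star (hA.eigenvectorUnitary : Matrix n n ℂ)).mulVec v) := by
    rw [Matrix.star_mulVec, Matrix.star_eq_conjTranspose, Matrix.conjTranspose_conjTranspose]
  rw [h, dotProduct, Complex.re_sum]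
  refine Finset.sum_congr rfl fun i _ => ?_
  rw [Matrix.mulVec_diagonal, eigenWeight, Complex.normSq_apply]
  simp
  ring

lemma quadForm_eq_sum {A : Matrix n n ℂ} (hA : A.IsHermitian) (v : n → ℂ) :
    quadForm A v = ∑ i, hA.eigenvalues i * eigenWeight hA v i := by
  conv_lhs => rw [← cfc_id' ℝ A hA]
  exact quadForm_cfc hA (fun x => x) v

lemma sum_eigenWeight {A : Matrix n n ℂ} (hA : A.IsHermitian) (v : n → ℂ) :
    ∑ i, eigenWeight hA v i = quadForm 1 v := by
  have hA' : IsSelfAdjoint A := hA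
  have h : cfc (fun _ : ℝ => (1 : ℝ)) A = 1 := cfc_const_one ℝ A
  rw [← h, quadForm_cfc hA]
  simp

lemma trace_cfc {A : Matrix n n ℂ} (hA : A.IsHermitian) (f : ℝ → ℝ) :
    (cfc f A).trace.re = ∑ i, f (hA.eigenvalues i) := by
  rw [hA.cfc_eq, Matrix.IsHermitian.cfc, Unitary.conjStarAlgAut_apply, Matrix.trace_mul_comm,
    ← mul_assoc, Unitary.coe_star_mul_self, one_mul, Matrix.trace_diagonal, Complex.re_sum]
  simp

/-- `A * B` and `B * A` share their characteristic polynomial, hence their eigenvalues with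
multiplicity. -/
lemma trace_cfc_mul_comm {A B : Matrix n n ℂ} (hAB : (A * B).IsHermitian) (hBA : (B * A).IsHermitian)
    (f : ℝ → ℝ) : (cfc f (A * B)).trace.re = (cfc f (B * A)).trace.re := by
  rw [trace_cfc hAB, trace_cfc hBA,
    (hAB.eigenvalues_eq_eigenvalues_iff hBA).2 (Matrix.charpoly_mul_comm A B)]

/-- The columns of a unitary matrix. -/
def unitaryCol (U : Matrix.unitaryGroup n ℂ) (i : n) : n → ℂ :=
  (U : Matrix n n ℂ).mulVec (Pi.single i 1)

lemma quadForm_one_unitaryCol (U : Matrix.unitaryGroup n ℂ) (i : n) :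
    quadForm 1 (unitaryCol U i) = 1 := by
  rw [quadForm, Matrix.one_mulVec, unitaryCol, Matrix.star_mulVec, ← Matrix.dotProduct_mulVec,
    Matrix.mulVec_mulVec, ← Matrix.star_eq_conjTranspose, Unitary.coe_star_mul_self,
    Matrix.one_mulVec]
  simp

lemma quadForm_eigenvector {A : Matrix n n ℂ} (hA : A.IsHermitian) (i : n) :
    quadForm A (unitaryCol hA.eigenvectorUnitary i) = hA.eigenvalues i := by
  have h : unitaryCol hA.eigenvectorUnitary i = (hA.eigenvectorBasis i).ofLp :=
    hA.eigenvectorUnitary_mulVec i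
  have h1 := quadForm_one_unitaryCol hA.eigenvectorUnitary i
  rw [quadForm, Matrix.one_mulVec] at h1
  rw [quadForm, h, hA.mulVec_eigenvectorBasis, ← h, dotProduct_smul, Complex.smul_re, h1,
    smul_eq_mul, mul_one]

/-- The weights are squared moduli of entries of the unitary `V* U`. With `sum_eigenWeight` they
form a doubly stochastic matrix, which drives Peierls' inequality. -/
lemma sum_eigenWeight_unitaryCol {A : Matrix n n ℂ} (hA : A.IsHermitian)
    (U : Matrix.unitaryGroup n ℂ) (j : n) : ∑ i, eigenWeight hA (unitaryCol U i) j = 1 := by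
  set V := hA.eigenvectorUnitary
  have h : ∀ i, (star (V : Matrix n n ℂ)).mulVec (unitaryCol U i) j =
      ((star V * U : Matrix.unitaryGroup n ℂ) : Matrix n n ℂ) j i := fun i => by
    rw [unitaryCol, Matrix.mulVec_mulVec, Matrix.mulVec_single_one]
    rfl
  set W : Matrix.unitaryGroup n ℂ := star V * U
  have h1 := congrFun (congrFun (Unitary.coe_mul_star_self W) j) j
  rw [Matrix.mul_apply, Matrix.one_apply_eq] at h1
  have h2 := congrArg Complex.re h1
  rw [Complex.re_sum, Complex.one_re] at h2
  rw [← h2]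
  refine Finset.sum_congr rfl fun i _ => ?_
  rw [eigenWeight, h]
  change _ = ((W : Matrix n n ℂ) j i * star ((W : Matrix n n ℂ) j i)).re
  rw [Complex.normSq_apply]
  simp

/-- Peierls' inequality. -/
lemma sum_quadForm_le_trace_cfc {f : ℝ → ℝ} (hf : ConvexOn ℝ (Set.Ici 0) f) {A : Matrix n n ℂ}
    (hA : A.PosSemidef) (U : Matrix.unitaryGroup n ℂ) :
    ∑ i, f (quadForm A (unitaryCol U i)) ≤ (cfc f A).trace.re := by
  rw [trace_cfc hA.1]
  calc ∑ i, f (quadForm A (unitaryCol U i))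
      ≤ ∑ i, ∑ j, eigenWeight hA.1 (unitaryCol U i) j * f (hA.1.eigenvalues j) := by
        refine Finset.sum_le_sum fun i _ => ?_
        have h := hf.map_sum_le (t := Finset.univ) (w := eigenWeight hA.1 (unitaryCol U i))
          (p := hA.1.eigenvalues) (fun j _ => eigenWeight_nonneg _ _ j)
          (by rw [sum_eigenWeight, quadForm_one_unitaryCol]) (fun j _ => hA.eigenvalues_nonneg j)
        simp only [smul_eq_mul] at h
        rw [quadForm_eq_sum hA.1]
        simpa only [mul_comm] using h
    _ = ∑ j, f (hA.1.eigenvalues j) := by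
        rw [Finset.sum_comm]
        refine Finset.sum_congr rfl fun j _ => ?_
        rw [← Finset.sum_mul, sum_eigenWeight_unitaryCol, one_mul]

/-- Trace functionals of convex functions are convex, in a form that also uses monotonicity. -/
lemma trace_cfc_le_of_quadForm {f : ℝ → ℝ} (hf : ConvexOn ℝ (Set.Ici 0) f) {T A B : Matrix n n ℂ}
    (hT : T.PosSemidef) (hA : A.PosSemidef) (hB : B.PosSemidef) {s t : ℝ} (hs : 0 < s) (ht : 0 < t)
    (hst : s + t = 1)
    (h : ∀ v, f (quadForm T v) ≤ f (s * quadForm A v + t * quadForm B v)) :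
    (cfc f T).trace.re ≤ s * (cfc f A).trace.re + t * (cfc f B).trace.re := by
  rw [trace_cfc hT.1]
  set U := hT.1.eigenvectorUnitary
  calc ∑ i, f (hT.1.eigenvalues i)
      ≤ ∑ i, (s * f (quadForm A (unitaryCol U i)) + t * f (quadForm B (unitaryCol U i))) := by
        refine Finset.sum_le_sum fun i _ => ?_
        -- In the eigenbasis of `T` the trace is a sum of scalars; Peierls' inequality then handles
        -- `A` and `B`, which this basis need not diagonalise.
        rw [← quadForm_eigenvector hT.1 i]
        exact (h _).trans (hf.2 (quadForm_nonneg hA _) (quadForm_nonneg hB _) hs.le ht.le hst)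
    _ ≤ _ := by
        rw [Finset.sum_add_distrib, ← Finset.mul_sum, ← Finset.mul_sum]
        exact add_le_add (mul_le_mul_of_nonneg_left (sum_quadForm_le_trace_cfc hf hA U) hs.le)
          (mul_le_mul_of_nonneg_left (sum_quadForm_le_trace_cfc hf hB U) ht.le)

lemma mpow_isHermitian (A : Matrix n n ℂ) (s : ℝ) : (mpow A s).IsHermitian :=
  cfc_predicate (R := ℝ) (p := IsSelfAdjoint) _ A

lemma quadForm_conj {R : Matrix n n ℂ} (hR : R.IsHermitian) (A : Matrix n n ℂ) (v : n → ℂ) :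
    quadForm (R * A * R) v = quadForm A (R.mulVec v) := by
  rw [quadForm, quadForm, Matrix.star_mulVec, hR.eq, ← Matrix.dotProduct_mulVec,
    Matrix.mulVec_mulVec, Matrix.mulVec_mulVec, mul_assoc]

lemma cfc_posSemidef {A : Matrix n n ℂ} (hA : A.PosSemidef) {f : ℝ → ℝ}
    (hf : ∀ x, 0 ≤ x → 0 ≤ f x) : (cfc f A).PosSemidef := by
  refine posSemidef_of_quadForm_nonneg (cfc_predicate (R := ℝ) (p := IsSelfAdjoint) f A) fun v => ?_
  rw [quadForm_cfc hA.1]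
  exact Finset.sum_nonneg fun i _ =>
    mul_nonneg (hf _ (hA.eigenvalues_nonneg i)) (eigenWeight_nonneg _ _ _)

lemma mpow_posSemidef {A : Matrix n n ℂ} (hA : A.PosSemidef) (s : ℝ) : (mpow A s).PosSemidef :=
  cfc_posSemidef hA fun _ hx => Real.rpow_nonneg hx s

lemma conj_posSemidef {A R : Matrix n n ℂ} (hA : A.PosSemidef) (hR : R.IsHermitian) :
    (R * A * R).PosSemidef := by
  have h := hA.conjTranspose_mul_mul_same R
  rwa [hR.eq] at h

lemma spectrum_nonneg_of_posSemidef {A : Matrix n n ℂ} (hA : A.PosSemidef) {x : ℝ}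
    (hx : x ∈ spectrum ℝ A) : 0 ≤ x := by
  rw [hA.1.spectrum_real_eq_range_eigenvalues] at hx
  obtain ⟨i, rfl⟩ := hx
  exact hA.eigenvalues_nonneg i

lemma mpow_smul {A : Matrix n n ℂ} (hA : A.PosSemidef) {c : ℝ} (hc : 0 ≤ c) (s : ℝ) :
    mpow ((c : ℂ) • A) s = ((c ^ s : ℝ) : ℂ) • mpow A s := by
  have hA' : IsSelfAdjoint A := hA.1
  change cfc (fun x : ℝ => x ^ s) (c • A) = (c ^ s) • cfc (fun x : ℝ => x ^ s) A
  rw [← cfc_comp_const_mul c (fun x : ℝ => x ^ s) A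
    ((A.finite_real_spectrum.image _).continuousOn _) hA',
    ← cfc_const_mul (c ^ s) (fun x : ℝ => x ^ s) A (continuousOn_spectrum A _)]
  exact cfc_congr fun x hx => Real.mul_rpow hc (spectrum_nonneg_of_posSemidef hA hx)

lemma mpow_mul_self {A : Matrix n n ℂ} (hA : A.PosSemidef) {s : ℝ} (hs : s ≠ 0) :
    mpow A s * mpow A s = mpow A (2 * s) := by
  rw [mpow, ← cfc_mul (fun x : ℝ => x ^ s) (fun x : ℝ => x ^ s) A (continuousOn_spectrum A _)
    (continuousOn_spectrum A _)]
  refine cfc_congr fun x hx => ?_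
  rcases (spectrum_nonneg_of_posSemidef hA hx).eq_or_lt with rfl | h
  · simp [Real.zero_rpow hs, Real.zero_rpow (mul_ne_zero two_ne_zero hs)]
  · simp only [← Real.rpow_add h, two_mul]

open scoped MatrixOrder in
lemma exists_sqrt {A : Matrix n n ℂ} (hA : A.PosSemidef) :
    ∃ R : Matrix n n ℂ, R.IsHermitian ∧ R * R = A :=
  ⟨CFC.sqrt A, (Matrix.nonneg_iff_posSemidef.1 (CFC.sqrt_nonneg A)).1,
    CFC.sqrt_mul_sqrt_self A hA.nonneg⟩

lemma mulVec_eq_zero_of_sq {R A : Matrix n n ℂ} (hR : R.IsHermitian) (hRA : R * R = A) {v : n → ℂ}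
    (hv : A.mulVec v = 0) : R.mulVec v = 0 := by
  rw [← dotProduct_star_self_eq_zero, Matrix.star_mulVec, hR.eq,
    ← Matrix.dotProduct_mulVec, Matrix.mulVec_mulVec, hRA, hv, dotProduct_zero]

lemma mulVec_eq_zero_of_quadForm {A : Matrix n n ℂ} (hA : A.PosSemidef) {v : n → ℂ}
    (hv : quadForm A v = 0) : A.mulVec v = 0 := by
  rw [← hA.dotProduct_mulVec_zero_iff]
  exact Complex.ext hv (hA.1.im_star_dotProduct_mulVec_self v)

end SpectralCalculus

/-! ### Operator convexity of powers and of the logarithm. -/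

section OperatorConvexity

open scoped MatrixOrder Matrix.Norms.L2Operator

variable {n : Type*} [Fintype n] [DecidableEq n]

lemma quadForm_mono {A B : Matrix n n ℂ} (h : A ≤ B) (v : n → ℂ) : quadForm A v ≤ quadForm B v := by
  have := quadForm_nonneg (Matrix.le_iff.1 h) v
  rwa [quadForm_sub, sub_nonneg] at this

lemma rpow_eq_mpow {A : Matrix n n ℂ} (hA : A.PosSemidef) (q : ℝ) : A ^ q = mpow A q :=
  CFC.rpow_eq_cfc_real hA.nonneg

lemma mpow_concave {q : ℝ} (hq0 : 0 ≤ q) (hq1 : q ≤ 1) {A B : Matrix n n ℂ} (hA : A.PosSemidef)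
    (hB : B.PosSemidef) {s t : ℝ} (hs : 0 ≤ s) (ht : 0 ≤ t) (hst : s + t = 1) :
    (s : ℂ) • mpow A q + (t : ℂ) • mpow B q ≤ mpow ((s : ℂ) • A + (t : ℂ) • B) q := by
  have h := (CFC.concaveOn_rpow (A := Matrix n n ℂ) ⟨hq0, hq1⟩).2 hA.nonneg hB.nonneg hs ht hst
  have hmix : ((s : ℂ) • A + (t : ℂ) • B).PosSemidef :=
    (PosSemidef.real_smul hA hs).add (PosSemidef.real_smul hB ht)
  rw [← rpow_eq_mpow hA, ← rpow_eq_mpow hB, ← rpow_eq_mpow hmix]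
  exact h

lemma mpow_posDef {A : Matrix n n ℂ} (hA : A.PosDef) (q : ℝ) : (mpow A q).PosDef := by
  rw [← rpow_eq_mpow hA.posSemidef]
  exact Matrix.isStrictlyPositive_iff_posDef.1
    (IsStrictlyPositive.rpow A q (Matrix.isStrictlyPositive_iff_posDef.2 hA))

lemma mpow_neg_eq_inverse {A : Matrix n n ℂ} (hA : A.PosDef) (q : ℝ) :
    mpow A (-q) = Ring.inverse (mpow A q) := by
  have hA' : IsSelfAdjoint A := hA.1
  have hpos : ∀ x ∈ spectrum ℝ A, 0 < x := fun x hx =>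
    (Matrix.isStrictlyPositive_iff_posDef.2 hA).spectrum_pos hx
  rw [mpow, mpow, ← cfc_inv (fun x : ℝ => x ^ q) A
    (fun x hx => (Real.rpow_pos_of_pos (hpos x hx) q).ne') (continuousOn_spectrum A _)]
  exact cfc_congr fun x hx => Real.rpow_neg (hpos x hx).le q

lemma posDef_mix {A B : Matrix n n ℂ} (hA : A.PosDef) (hB : B.PosDef) {s t : ℝ} (hs : 0 < s)
    (ht : 0 < t) : ((s : ℂ) • A + (t : ℂ) • B).PosDef :=
  (hA.smul (show (0 : ℂ) < s by exact_mod_cast hs)).add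
    (hB.smul (show (0 : ℂ) < t by exact_mod_cast ht))

/-- Operator concavity of the `q`-th power, followed by the inverse, which is antitone and operator
convex. -/
lemma mpow_neg_convex {q : ℝ} (hq0 : 0 ≤ q) (hq1 : q ≤ 1) {A B : Matrix n n ℂ} (hA : A.PosDef)
    (hB : B.PosDef) {s t : ℝ} (hs : 0 < s) (ht : 0 < t) (hst : s + t = 1) :
    mpow ((s : ℂ) • A + (t : ℂ) • B) (-q) ≤ (s : ℂ) • mpow A (-q) + (t : ℂ) • mpow B (-q) := by
  have h1 := mpow_concave hq0 hq1 hA.posSemidef hB.posSemidef hs.le ht.le hst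
  have h2 := CStarAlgebra.ringInverse_le_ringInverse h1 (Matrix.isStrictlyPositive_iff_posDef.2
    (posDef_mix (mpow_posDef hA q) (mpow_posDef hB q) hs ht))
  have h3 := (CStarAlgebra.convexOn_ringInverse (A := Matrix n n ℂ)).2
    (Matrix.isStrictlyPositive_iff_posDef.2 (mpow_posDef hA q))
    (Matrix.isStrictlyPositive_iff_posDef.2 (mpow_posDef hB q)) hs.le ht.le hst
  rw [mpow_neg_eq_inverse (posDef_mix hA hB hs ht), mpow_neg_eq_inverse hA,
    mpow_neg_eq_inverse hB]
  exact h2.trans h3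

lemma mlog_concave {A B : Matrix n n ℂ} (hA : A.PosDef)
    (hB : B.PosDef) {s t : ℝ} (hs : 0 < s) (ht : 0 < t) (hst : s + t = 1) :
    (s : ℂ) • mlog A + (t : ℂ) • mlog B ≤ mlog ((s : ℂ) • A + (t : ℂ) • B) :=
  (CFC.concaveOn_log (A := Matrix n n ℂ)).2 (Matrix.isStrictlyPositive_iff_posDef.2 hA)
    (Matrix.isStrictlyPositive_iff_posDef.2 hB) hs.le ht.le hst

/-- `f` is operator convex on positive definite matrices. -/
def OperatorConvex (n : Type*) [Fintype n] [DecidableEq n] (f : ℝ → ℝ) : Prop :=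
  ∀ A B : Matrix n n ℂ, A.PosDef → B.PosDef → ∀ s t : ℝ, 0 < s → 0 < t → s + t = 1 → ∀ v,
    quadForm (cfc f ((s : ℂ) • A + (t : ℂ) • B)) v ≤
      s * quadForm (cfc f A) v + t * quadForm (cfc f B) v

lemma operatorConvex_rpow {q : ℝ} (hq0 : q ≤ 0) (hq1 : -1 ≤ q) :
    OperatorConvex n fun x : ℝ => x ^ q := by
  intro A B hA hB s t hs ht hst v
  have h := quadForm_mono (mpow_neg_convex (q := -q) (by linarith) (by linarith) hA hB hs ht hst) v
  rw [neg_neg, quadForm_add, quadForm_smul, quadForm_smul] at h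
  exact h

lemma cfc_neg_log (A : Matrix n n ℂ) : cfc (fun x : ℝ => -Real.log x) A = -mlog A :=
  cfc_neg Real.log A

lemma quadForm_neg (A : Matrix n n ℂ) (v : n → ℂ) : quadForm (-A) v = -quadForm A v := by
  simp [quadForm, Matrix.neg_mulVec]

lemma operatorConvex_neg_log : OperatorConvex n fun x : ℝ => -Real.log x := by
  intro A B hA hB s t hs ht hst v
  have h := quadForm_mono (mlog_concave hA hB hs ht hst) v
  rw [quadForm_add, quadForm_smul, quadForm_smul] at h
  rw [cfc_neg_log, cfc_neg_log, cfc_neg_log, quadForm_neg, quadForm_neg, quadForm_neg]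
  linarith

end OperatorConvexity

/-! ### Extension to singular matrices. -/

section Regularization

variable {n : Type*} [Fintype n] [DecidableEq n]

lemma cfc_add_scalar {A : Matrix n n ℂ} (hA : A.IsHermitian) (f : ℝ → ℝ) (δ : ℝ) :
    cfc f (A + (δ : ℂ) • 1) = cfc (fun x => f (x + δ)) A := by
  have hA' : IsSelfAdjoint A := hA
  have h1 : cfc (fun x : ℝ => x + δ) A = A + (δ : ℂ) • 1 := by
    rw [cfc_add_const δ (fun x : ℝ => x) A (continuousOn_spectrum A _) hA', cfc_id' ℝ A hA',
      Algebra.algebraMap_eq_smul_one]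
    rfl
  rw [← h1, cfc_comp' f (fun x => x + δ) A ((A.finite_real_spectrum.image _).continuousOn _)
    (continuousOn_spectrum A _) hA']

lemma eigenWeight_eq_zero {A : Matrix n n ℂ} (hA : A.IsHermitian) {v : n → ℂ}
    (hv : ∀ u, A.mulVec u = 0 → star u ⬝ᵥ v = 0) {i : n} (hi : hA.eigenvalues i = 0) :
    eigenWeight hA v i = 0 := by
  have h1 := hv (hA.eigenvectorBasis i).ofLp (by rw [hA.mulVec_eigenvectorBasis, hi, zero_smul])
  rw [eigenWeight, Complex.normSq_eq_zero, ← h1]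
  rfl

/-- A vector orthogonal to the kernel has no weight on null eigenvectors, so the behaviour of `f` at
zero plays no role. -/
lemma tendsto_quadForm_cfc {A : Matrix n n ℂ} (hA : A.PosSemidef) {f : ℝ → ℝ}
    (hf : ContinuousOn f (Set.Ioi 0)) {v : n → ℂ}
    (hv : ∀ u, A.mulVec u = 0 → star u ⬝ᵥ v = 0) :
    Filter.Tendsto (fun δ : ℝ => quadForm (cfc f (A + (δ : ℂ) • 1)) v)
      (nhdsWithin 0 (Set.Ioi 0)) (nhds (quadForm (cfc f A) v)) := by
  simp only [cfc_add_scalar hA.1, quadForm_cfc hA.1]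
  refine tendsto_finsetSum _ fun i _ => ?_
  by_cases hi : hA.1.eigenvalues i = 0
  · simp [eigenWeight_eq_zero hA.1 hv hi]
  · refine Filter.Tendsto.mul_const _ ?_
    have hpos : 0 < hA.1.eigenvalues i := (hA.eigenvalues_nonneg i).lt_of_ne' hi
    have h1 : ContinuousAt f (hA.1.eigenvalues i + 0) := by
      rw [add_zero]; exact hf.continuousAt (Ioi_mem_nhds hpos)
    have h2 : Filter.Tendsto (fun δ => hA.1.eigenvalues i + δ) (nhds (0 : ℝ))
        (nhds (hA.1.eigenvalues i + 0)) := (continuous_const.add continuous_id).tendsto 0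
    have h3 := (h1.tendsto.comp h2).mono_left (nhdsWithin_le_nhds (s := Set.Ioi 0))
    rwa [add_zero] at h3

lemma posDef_add_scalar {A : Matrix n n ℂ} (hA : A.PosSemidef) {δ : ℝ} (hδ : 0 < δ) :
    (A + (δ : ℂ) • 1).PosDef :=
  Matrix.PosDef.posSemidef_add hA (Matrix.PosDef.one.smul (show (0 : ℂ) < δ by exact_mod_cast hδ))

lemma SuppLE.mix {ρ σ₁ σ₂ : Matrix n n ℂ} (h₁ : σ₁.PosSemidef) (h₂ : σ₂.PosSemidef)
    (h : SuppLE ρ σ₁) {s t : ℝ} (hs : 0 < s) (ht : 0 < t) :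
    SuppLE ρ ((s : ℂ) • σ₁ + (t : ℂ) • σ₂) := by
  intro v hv
  refine h v (mulVec_eq_zero_of_quadForm h₁ ?_)
  have h0 : quadForm ((s : ℂ) • σ₁ + (t : ℂ) • σ₂) v = 0 := by
    rw [quadForm, hv, dotProduct_zero, Complex.zero_re]
  rw [quadForm_add, quadForm_smul, quadForm_smul] at h0
  have h3 := mul_nonneg hs.le (quadForm_nonneg h₁ v)
  have h4 := mul_nonneg ht.le (quadForm_nonneg h₂ v)
  exact (mul_eq_zero.1 (by linarith)).resolve_left hs.ne'

/-- The range of a Hermitian square root of `ρ` is orthogonal to `ker ρ`, which contains `ker σ`. -/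
lemma dotProduct_eq_zero_of_suppLE {ρ σ R : Matrix n n ℂ} (hR : R.IsHermitian) (hRρ : R * R = ρ)
    (h : SuppLE ρ σ) (w : n → ℂ) (u : n → ℂ) (hu : σ.mulVec u = 0) : star u ⬝ᵥ R.mulVec w = 0 := by
  have h1 := mulVec_eq_zero_of_sq hR hRρ (h u hu)
  rw [Matrix.dotProduct_mulVec]
  have h2 : Matrix.vecMul (star u) R = star (R.mulVec u) := by rw [Matrix.star_mulVec, hR.eq]
  rw [h2, h1, star_zero, zero_dotProduct]

/-- Operator convexity extends to singular matrices on the common support. -/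
lemma OperatorConvex.quadForm_le {f : ℝ → ℝ} (hconv : OperatorConvex n f)
    (hf : ContinuousOn f (Set.Ioi 0)) {ρ σ₁ σ₂ R : Matrix n n ℂ} (hR : R.IsHermitian)
    (hRρ : R * R = ρ) (h₁ : σ₁.PosSemidef) (h₂ : σ₂.PosSemidef) (hs₁ : SuppLE ρ σ₁)
    (hs₂ : SuppLE ρ σ₂) {s t : ℝ} (hs : 0 < s) (ht : 0 < t) (hst : s + t = 1) (w : n → ℂ) :
    quadForm (cfc f ((s : ℂ) • σ₁ + (t : ℂ) • σ₂)) (R.mulVec w) ≤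
      s * quadForm (cfc f σ₁) (R.mulVec w) + t * quadForm (cfc f σ₂) (R.mulVec w) := by
  have hmix : ((s : ℂ) • σ₁ + (t : ℂ) • σ₂).PosSemidef :=
    (PosSemidef.real_smul h₁ hs.le).add (PosSemidef.real_smul h₂ ht.le)
  have t1 := tendsto_quadForm_cfc hmix hf
    (dotProduct_eq_zero_of_suppLE hR hRρ (hs₁.mix h₁ h₂ hs ht) w)
  have t2 := tendsto_quadForm_cfc h₁ hf (dotProduct_eq_zero_of_suppLE hR hRρ hs₁ w)
  have t3 := tendsto_quadForm_cfc h₂ hf (dotProduct_eq_zero_of_suppLE hR hRρ hs₂ w)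
  refine le_of_tendsto_of_tendsto t1 ((t2.const_mul s).add (t3.const_mul t)) ?_
  refine Filter.eventually_of_mem self_mem_nhdsWithin fun δ hδ => ?_
  -- Since `s + t = 1`, mixing the regularised matrices regularises the mixture by the same `δ`.
  have h := hconv _ _ (posDef_add_scalar h₁ hδ) (posDef_add_scalar h₂ hδ) s t hs ht hst (R.mulVec w)
  rwa [smul_add, smul_add, add_add_add_comm, ← add_smul, ← Complex.ofReal_add, hst,
    Complex.ofReal_one, one_smul] at h

end Regularization

/-! ### Convexity and bounds for the sandwiched functionals. -/

section SandwichedFunctional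

variable {n : Type*} [Fintype n] [DecidableEq n]

/-- The trace functional of the sandwiched Rényi divergence. -/
def sandwichedTrace (a : ℝ) (ρ σ : Matrix n n ℂ) : ℝ :=
  (mpow (mpow σ ((1 - a) / (2 * a)) * ρ * mpow σ ((1 - a) / (2 * a))) a).trace.re

/-- With `S` the outer power of `σ`, the two arguments are `(S R)(R S)` and `(R S)(S R)`. Afterwards
`σ` occurs once, through the power `(1 - a) / a`, where operator convexity applies. -/
lemma sandwichedTrace_eq {a : ℝ} (h0 : 0 < a) (h1 : a ≠ 1) {ρ σ R : Matrix n n ℂ}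
    (hR : R.IsHermitian) (hRρ : R * R = ρ) (hσ : σ.PosSemidef) :
    sandwichedTrace a ρ σ = (cfc (fun x : ℝ => x ^ a) (R * mpow σ ((1 - a) / a) * R)).trace.re := by
  have hs : (1 - a) / (2 * a) ≠ 0 :=
    div_ne_zero (sub_ne_zero.2 (Ne.symm h1)) (mul_ne_zero two_ne_zero h0.ne')
  set S := mpow σ ((1 - a) / (2 * a)) with hS
  have hSh : S.IsHermitian := mpow_isHermitian _ _
  have hSS : S * S = mpow σ ((1 - a) / a) := by
    rw [hS, mpow_mul_self hσ hs]
    congr 1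
    field_simp
  have e1 : S * ρ * S = (S * R) * (R * S) := by rw [← hRρ]; simp only [mul_assoc]
  have e2 : R * mpow σ ((1 - a) / a) * R = (R * S) * (S * R) := by
    rw [← hSS]; simp only [mul_assoc]
  rw [sandwichedTrace, mpow, ← hS, e1, e2]
  refine trace_cfc_mul_comm ?_ ?_ _
  · rw [Matrix.IsHermitian, Matrix.conjTranspose_mul, Matrix.conjTranspose_mul,
      Matrix.conjTranspose_mul, hSh.eq, hR.eq]
  · rw [Matrix.IsHermitian, Matrix.conjTranspose_mul, Matrix.conjTranspose_mul,
      Matrix.conjTranspose_mul, hSh.eq, hR.eq]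

lemma sandwichedTrace_nonneg {a : ℝ} {ρ σ : Matrix n n ℂ} (hρ : ρ.PosSemidef) :
    0 ≤ sandwichedTrace a ρ σ :=
  (Complex.nonneg_iff.1
    (mpow_posSemidef (conj_posSemidef hρ (mpow_isHermitian _ _)) a).trace_nonneg).1

/-- Here `(1 - a) / a` lies in `[-1, 0]`, an operator convex power, and `x ^ a` is increasing and
convex. -/
lemma sandwichedTrace_convex {a : ℝ} (h1 : 1 < a) {ρ σ₁ σ₂ : Matrix n n ℂ} (hρ : ρ.PosSemidef)
    (h₁ : σ₁.PosSemidef) (h₂ : σ₂.PosSemidef) (hs₁ : SuppLE ρ σ₁) (hs₂ : SuppLE ρ σ₂)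
    {s t : ℝ} (hs : 0 < s) (ht : 0 < t) (hst : s + t = 1) :
    sandwichedTrace a ρ ((s : ℂ) • σ₁ + (t : ℂ) • σ₂) ≤
      s * sandwichedTrace a ρ σ₁ + t * sandwichedTrace a ρ σ₂ := by
  have h0 : 0 < a := by linarith
  obtain ⟨R, hR, hRρ⟩ := exists_sqrt hρ
  have hmix : ((s : ℂ) • σ₁ + (t : ℂ) • σ₂).PosSemidef :=
    (PosSemidef.real_smul h₁ hs.le).add (PosSemidef.real_smul h₂ ht.le)
  rw [sandwichedTrace_eq h0 h1.ne' hR hRρ hmix, sandwichedTrace_eq h0 h1.ne' hR hRρ h₁,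
    sandwichedTrace_eq h0 h1.ne' hR hRρ h₂]
  refine trace_cfc_le_of_quadForm (convexOn_rpow h1.le)
    (conj_posSemidef (mpow_posSemidef hmix _) hR) (conj_posSemidef (mpow_posSemidef h₁ _) hR)
    (conj_posSemidef (mpow_posSemidef h₂ _) hR) hs ht hst fun v => ?_
  refine Real.rpow_le_rpow
    (quadForm_nonneg (conj_posSemidef (mpow_posSemidef hmix _) hR) v) ?_ h0.le
  rw [quadForm_conj hR, quadForm_conj hR, quadForm_conj hR]
  refine OperatorConvex.quadForm_le
    (operatorConvex_rpow (div_nonpos_of_nonpos_of_nonneg (by linarith) h0.le) ?_)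
    (fun x hx => (Real.continuousAt_rpow_const x _ (Or.inl (ne_of_gt hx))).continuousWithinAt)
    hR hRρ h₁ h₂ hs₁ hs₂ hs ht hst v
  rw [le_div_iff₀ h0]
  linarith

/-- The condition `a ≥ 1/2` is exactly `(1 - a) / a ≤ 1`, the range of operator concavity. The power
is nonnegative, so no support condition arises. -/
lemma sandwichedTrace_concave {a : ℝ} (ha : 1 / 2 ≤ a) (h1 : a < 1) {ρ σ₁ σ₂ : Matrix n n ℂ}
    (hρ : ρ.PosSemidef) (h₁ : σ₁.PosSemidef) (h₂ : σ₂.PosSemidef)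
    {s t : ℝ} (hs : 0 < s) (ht : 0 < t) (hst : s + t = 1) :
    s * sandwichedTrace a ρ σ₁ + t * sandwichedTrace a ρ σ₂ ≤
      sandwichedTrace a ρ ((s : ℂ) • σ₁ + (t : ℂ) • σ₂) := by
  have h0 : 0 < a := by linarith
  obtain ⟨R, hR, hRρ⟩ := exists_sqrt hρ
  have hmix : ((s : ℂ) • σ₁ + (t : ℂ) • σ₂).PosSemidef :=
    (PosSemidef.real_smul h₁ hs.le).add (PosSemidef.real_smul h₂ ht.le)
  rw [sandwichedTrace_eq h0 h1.ne hR hRρ hmix, sandwichedTrace_eq h0 h1.ne hR hRρ h₁,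
    sandwichedTrace_eq h0 h1.ne hR hRρ h₂]
  have hneg : ∀ A : Matrix n n ℂ, (cfc (fun x : ℝ => -x ^ a) A).trace.re =
      -(cfc (fun x : ℝ => x ^ a) A).trace.re := fun A => by
    rw [cfc_neg (fun x : ℝ => x ^ a) A, Matrix.trace_neg, Complex.neg_re]
  have h := trace_cfc_le_of_quadForm (f := fun x : ℝ => -x ^ a)
    (Real.concaveOn_rpow h0.le h1.le).neg
    (conj_posSemidef (mpow_posSemidef hmix ((1 - a) / a)) hR)
    (conj_posSemidef (mpow_posSemidef h₁ ((1 - a) / a)) hR)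
    (conj_posSemidef (mpow_posSemidef h₂ ((1 - a) / a)) hR) hs ht hst fun v => by
      refine neg_le_neg (Real.rpow_le_rpow ?_ ?_ h0.le)
      · exact add_nonneg
          (mul_nonneg hs.le (quadForm_nonneg (conj_posSemidef (mpow_posSemidef h₁ _) hR) v))
          (mul_nonneg ht.le (quadForm_nonneg (conj_posSemidef (mpow_posSemidef h₂ _) hR) v))
      · rw [quadForm_conj hR, quadForm_conj hR, quadForm_conj hR, ← quadForm_smul, ← quadForm_smul,
          ← quadForm_add]
        refine quadForm_mono (mpow_concave (div_nonneg (by linarith) h0.le) ?_ h₁ h₂ hs.le ht.le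
          hst) _
        rw [div_le_one h0]
        linarith
  rw [hneg, hneg, hneg] at h
  linarith

lemma eigenvalues_le_one {A : Matrix n n ℂ} (hA : A.PosSemidef) (htr : A.trace = 1) (i : n) :
    hA.1.eigenvalues i ≤ 1 := by
  have h := hA.1.trace_eq_sum_eigenvalues
  rw [htr] at h
  have h1 : ∑ i, hA.1.eigenvalues i = 1 := by simpa using (congrArg Complex.re h).symm
  rw [← h1]
  exact Finset.single_le_sum (fun j _ => hA.eigenvalues_nonneg j) (Finset.mem_univ i)

lemma quadForm_cfc_le {A : Matrix n n ℂ} (hA : A.PosSemidef) {f : ℝ → ℝ} {c : ℝ}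
    (h : ∀ i, f (hA.1.eigenvalues i) ≤ c) (v : n → ℂ) :
    quadForm (cfc f A) v ≤ c * quadForm 1 v := by
  rw [quadForm_cfc hA.1, ← sum_eigenWeight hA.1, Finset.mul_sum]
  exact Finset.sum_le_sum fun i _ => mul_le_mul_of_nonneg_right (h i) (eigenWeight_nonneg _ _ _)

lemma sandwichedTrace_le_card {a : ℝ} (h0 : 0 < a) (h1 : a < 1) {ρ σ : Matrix n n ℂ}
    (hρ : ρ.PosSemidef) (hσ : σ.PosSemidef) (htρ : ρ.trace = 1) (htσ : σ.trace = 1) :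
    sandwichedTrace a ρ σ ≤ Fintype.card n := by
  obtain ⟨R, hR, hRρ⟩ := exists_sqrt hρ
  rw [sandwichedTrace_eq h0 h1.ne hR hRρ hσ]
  have hT := conj_posSemidef (mpow_posSemidef hσ ((1 - a) / a)) hR
  rw [trace_cfc hT.1]
  have hle : ∀ i, hT.1.eigenvalues i ≤ 1 := fun i => by
    rw [← quadForm_eigenvector hT.1 i]
    set v := unitaryCol hT.1.eigenvectorUnitary i
    have e1 : quadForm (R * mpow σ ((1 - a) / a) * R) v ≤ 1 * quadForm 1 (R.mulVec v) := by
      rw [quadForm_conj hR]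
      exact quadForm_cfc_le hσ (f := fun x : ℝ => x ^ ((1 - a) / a))
        (fun i => Real.rpow_le_one (hσ.eigenvalues_nonneg i)
        (eigenvalues_le_one hσ htσ i) (div_nonneg (by linarith) h0.le)) _
    have e2 : quadForm 1 (R.mulVec v) = quadForm ρ v := by
      rw [← quadForm_conj hR, mul_one, hRρ]
    have e3 : quadForm ρ v ≤ 1 * quadForm 1 v := by
      have := quadForm_cfc_le hρ (f := fun x => x) (eigenvalues_le_one hρ htρ) v
      rwa [cfc_id' ℝ ρ (show IsSelfAdjoint ρ from hρ.1)] at this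
    rw [quadForm_one_unitaryCol] at e3
    linarith
  calc ∑ i, hT.1.eigenvalues i ^ a ≤ ∑ _i : n, (1 : ℝ) :=
        Finset.sum_le_sum fun i _ => Real.rpow_le_one (hT.eigenvalues_nonneg i) (hle i) h0.le
    _ = Fintype.card n := by simp

/-- The value of the relative entropy on its effective domain. -/
def relEntropyTrace (ρ σ : Matrix n n ℂ) : ℝ := (ρ * (mlog ρ - mlog σ)).trace.re

lemma trace_eq_sum_quadForm (A : Matrix n n ℂ) :
    A.trace.re = ∑ i, quadForm A (Pi.single i 1) := by
  rw [Matrix.trace, Complex.re_sum]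
  refine Finset.sum_congr rfl fun i _ => ?_
  simp [quadForm]

/-- Isolates the dependence on `σ` as quadratic forms of `-log σ` on the range of `R`, as
`OperatorConvex.quadForm_le` requires. -/
lemma relEntropyTrace_eq {ρ σ R : Matrix n n ℂ} (hR : R.IsHermitian) (hRρ : R * R = ρ) :
    relEntropyTrace ρ σ = (ρ * mlog ρ).trace.re +
      ∑ i, quadForm (cfc (fun x : ℝ => -Real.log x) σ) (R.mulVec (Pi.single i 1)) := by
  have h : ∑ i, quadForm (cfc (fun x : ℝ => -Real.log x) σ) (R.mulVec (Pi.single i 1)) =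
      -(ρ * mlog σ).trace.re := by
    simp only [← quadForm_conj hR]
    rw [← trace_eq_sum_quadForm, cfc_neg_log, Matrix.trace_mul_comm, ← mul_assoc, hRρ, mul_neg,
      Matrix.trace_neg, Complex.neg_re]
  rw [h, relEntropyTrace, mul_sub, Matrix.trace_sub, Complex.sub_re]
  ring

lemma relEntropyTrace_convex {ρ σ₁ σ₂ : Matrix n n ℂ} (hρ : ρ.PosSemidef)
    (h₁ : σ₁.PosSemidef) (h₂ : σ₂.PosSemidef) (hs₁ : SuppLE ρ σ₁) (hs₂ : SuppLE ρ σ₂)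
    {s t : ℝ} (hs : 0 < s) (ht : 0 < t) (hst : s + t = 1) :
    relEntropyTrace ρ ((s : ℂ) • σ₁ + (t : ℂ) • σ₂) ≤
      s * relEntropyTrace ρ σ₁ + t * relEntropyTrace ρ σ₂ := by
  obtain ⟨R, hR, hRρ⟩ := exists_sqrt hρ
  rw [relEntropyTrace_eq hR hRρ, relEntropyTrace_eq hR hRρ, relEntropyTrace_eq hR hRρ]
  have h := Finset.sum_le_sum fun i (_ : i ∈ Finset.univ) =>
    OperatorConvex.quadForm_le operatorConvex_neg_log
      (fun x hx => (Real.continuousAt_log (ne_of_gt hx)).neg.continuousWithinAt)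
      hR hRρ h₁ h₂ hs₁ hs₂ hs ht hst (Pi.single i 1)
  rw [Finset.sum_add_distrib, ← Finset.mul_sum, ← Finset.mul_sum] at h
  have h3 : s * (ρ * mlog ρ).trace.re + t * (ρ * mlog ρ).trace.re = (ρ * mlog ρ).trace.re := by
    rw [← add_mul, hst, one_mul]
  linarith

lemma le_relEntropyTrace {ρ σ : Matrix n n ℂ} (hρ : ρ.PosSemidef) (hσ : σ.PosSemidef)
    (htσ : σ.trace = 1) : (ρ * mlog ρ).trace.re ≤ relEntropyTrace ρ σ := by
  obtain ⟨R, hR, hRρ⟩ := exists_sqrt hρ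
  rw [relEntropyTrace_eq hR hRρ, le_add_iff_nonneg_right]
  refine Finset.sum_nonneg fun i _ => ?_
  rw [quadForm_cfc hσ.1]
  refine Finset.sum_nonneg fun j _ => mul_nonneg ?_ (eigenWeight_nonneg _ _ _)
  exact neg_nonneg.2 (Real.log_nonpos (hσ.eigenvalues_nonneg j) (eigenvalues_le_one hσ htσ j))

end SandwichedFunctional

/-! ### Functional calculus on block-diagonal matrices. -/

section BlockCalculus

variable {X B : Type*} [Fintype X] [DecidableEq X] [Fintype B] [DecidableEq B]

lemma blockSum_pow (M : X → Matrix B B ℂ) (k : ℕ) :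
    blockSum M ^ k = blockSum fun x => M x ^ k := by
  induction k with
  | zero => simp only [pow_zero, blockSum_one]
  | succ k ih => simp only [pow_succ, ih, blockSum_mul]

lemma aeval_blockSum (M : X → Matrix B B ℂ) (q : Polynomial ℝ) :
    Polynomial.aeval (blockSum M) q = blockSum fun x => Polynomial.aeval (M x) q := by
  induction q using Polynomial.induction_on' with
  | add q r hq hr => simp only [map_add, hq, hr, blockSum_add]
  | monomial k c =>
    simp only [Polynomial.aeval_monomial, ← Algebra.smul_def, blockSum_pow]
    exact blockSum_smul (c : ℂ) _

lemma blockSum_isHermitian {M : X → Matrix B B ℂ} (hM : ∀ x, (M x).IsHermitian) :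
    (blockSum M).IsHermitian := by
  rw [Matrix.IsHermitian, blockSum_conjTranspose]
  simp only [(hM _).eq]

lemma cfc_blockSum (f : ℝ → ℝ) {M : X → Matrix B B ℂ} (hM : ∀ x, (M x).IsHermitian) :
    cfc f (blockSum M) = blockSum fun x => cfc f (M x) := by
  have hfin : (spectrum ℝ (blockSum M) ∪ ⋃ x, spectrum ℝ (M x)).Finite :=
    (blockSum M).finite_real_spectrum.union (Set.finite_iUnion fun x => (M x).finite_real_spectrum)
  -- One polynomial agrees with `f` on all the finitely many eigenvalues involved, and polynomials
  -- act blockwise.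
  set q := Lagrange.interpolate hfin.toFinset id f
  have hq : ∀ y ∈ spectrum ℝ (blockSum M) ∪ ⋃ x, spectrum ℝ (M x), f y = q.eval y := fun y hy =>
    (Lagrange.eval_interpolate_at_node f (Set.injOn_id _) (hfin.mem_toFinset.2 hy)).symm
  have h0 : IsSelfAdjoint (blockSum M) := blockSum_isHermitian hM
  have h1 : ∀ x, IsSelfAdjoint (M x) := hM
  rw [cfc_congr (g := fun y => q.eval y) fun y hy => hq y (Or.inl hy), cfc_polynomial q _ h0,
    aeval_blockSum]
  congr 1
  ext1 x
  rw [cfc_congr (f := f) (g := fun y => q.eval y) fun y hy =>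
    hq y (Or.inr (Set.mem_iUnion.2 ⟨x, hy⟩)), cfc_polynomial q _ (h1 x)]

lemma mpow_blockSum_smul {w : X → ℝ} (hw : ∀ x, 0 ≤ w x) {M : X → Matrix B B ℂ}
    (hM : ∀ x, (M x).PosSemidef) (s : ℝ) :
    mpow (blockSum fun x => (w x : ℂ) • M x) s =
      blockSum fun x => ((w x ^ s : ℝ) : ℂ) • mpow (M x) s := by
  rw [mpow, cfc_blockSum _ fun x => (PosSemidef.real_smul (hM x) (hw x)).1]
  congr 1
  ext1 x
  exact mpow_smul (hM x) (hw x) s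

lemma sandwichedTrace_blockSum (a : ℝ) {p w : X → ℝ} (hp : ∀ x, 0 ≤ p x) (hw : ∀ x, 0 ≤ w x)
    {M : X → Matrix B B ℂ} (hM : ∀ x, (M x).PosSemidef) {σ : Matrix B B ℂ} (hσ : σ.PosSemidef) :
    sandwichedTrace a (blockSum fun x => (p x : ℂ) • M x) (blockSum fun x => (w x : ℂ) • σ) =
      ∑ x, (w x ^ ((1 - a) / (2 * a)) * p x * w x ^ ((1 - a) / (2 * a))) ^ a *
        sandwichedTrace a (M x) σ := by
  rw [sandwichedTrace, mpow_blockSum_smul hw (fun _ => hσ), blockSum_mul, blockSum_mul]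
  simp only [smul_mul_smul_comm, ← Complex.ofReal_mul]
  rw [mpow_blockSum_smul
    (fun x => mul_nonneg (mul_nonneg (Real.rpow_nonneg (hw x) _) (hp x))
      (Real.rpow_nonneg (hw x) _))
    (fun x => conj_posSemidef (hM x) (mpow_isHermitian _ _)), trace_blockSum, Complex.re_sum]
  refine Finset.sum_congr rfl fun x _ => ?_
  rw [Matrix.trace_smul, smul_eq_mul, Complex.re_ofReal_mul, sandwichedTrace]

lemma suppLE_blockSum_iff {p w : X → ℝ} (hpw : ∀ x, p x ≠ 0 → w x ≠ 0) (M : X → Matrix B B ℂ)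
    (σ : Matrix B B ℂ) :
    SuppLE (blockSum fun x => (p x : ℂ) • M x) (blockSum fun x => (w x : ℂ) • σ) ↔
      ∀ x, p x ≠ 0 → SuppLE (M x) σ := by
  constructor
  · intro h x hx v hv
    have h1 := h (fun i => if i.1 = x then v i.2 else 0) (by
      ext ⟨y, b⟩
      rw [blockSum_mulVec, Matrix.smul_mulVec]
      by_cases hy : y = x
      · simp [hy, hv]
      · simp [hy, show (fun _ : B => (0 : ℂ)) = 0 from rfl])
    ext b
    have h2 := congrFun h1 (x, b)
    rw [blockSum_mulVec, Matrix.smul_mulVec] at h2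
    simpa [hx] using h2
  · intro h v hv
    ext ⟨x, b⟩
    rw [blockSum_mulVec, Matrix.smul_mulVec]
    by_cases hx : p x = 0
    · simp [hx]
    · have h1 : σ.mulVec (fun c => v (x, c)) = 0 := by
        ext c
        have h2 := congrFun hv (x, c)
        rw [blockSum_mulVec, Matrix.smul_mulVec] at h2
        simpa [hpw x hx] using h2
      rw [h x hx _ h1]
      simp

lemma mul_eq_zero_of_suppLE {n : Type*} [Fintype n] {ρ σ A : Matrix n n ℂ} (h : SuppLE ρ σ)
    (hA : σ * A = 0) : ρ * A = 0 := by
  ext i j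
  have h1 : σ.mulVec (fun k => A k j) = 0 := by
    ext l
    exact congrFun (congrFun hA l) j
  exact congrFun (h _ h1) i

/-- The support projection of a Hermitian matrix. -/
def supportProj {n : Type*} [Fintype n] [DecidableEq n] (A : Matrix n n ℂ) : Matrix n n ℂ :=
  cfc (fun x : ℝ => if x = 0 then 0 else 1) A

lemma mul_supportProj {n : Type*} [Fintype n] [DecidableEq n] {ρ σ : Matrix n n ℂ}
    (hσ : σ.IsHermitian) (h : SuppLE ρ σ) : ρ * supportProj σ = ρ := by
  have hσ' : IsSelfAdjoint σ := hσ
  have h1 : σ * supportProj σ = σ := by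
    have h2 := cfc_mul (fun x : ℝ => x) (fun x : ℝ => if x = 0 then 0 else 1) σ
      (continuousOn_spectrum σ _) (continuousOn_spectrum σ _)
    rw [cfc_id' ℝ σ hσ'] at h2
    rw [supportProj, ← h2]
    conv_rhs => rw [← cfc_id' ℝ σ hσ']
    refine cfc_congr fun x _ => ?_
    by_cases hx : x = 0 <;> simp [hx]
  have h2 := mul_eq_zero_of_suppLE h (A := 1 - supportProj σ) (by rw [mul_sub, h1, mul_one, sub_self])
  rw [mul_sub, mul_one, sub_eq_zero] at h2
  exact h2.symm

/-- With `Real.log 0 = 0` the product rule fails at zero, so `log c` multiplies the support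
projection and not the identity. -/
lemma mlog_smul {n : Type*} [Fintype n] [DecidableEq n] {A : Matrix n n ℂ} (hA : A.IsHermitian)
    {c : ℝ} (hc : c ≠ 0) :
    mlog ((c : ℂ) • A) = ((Real.log c : ℝ) : ℂ) • supportProj A + mlog A := by
  have hA' : IsSelfAdjoint A := hA
  change cfc Real.log (c • A) = Real.log c • cfc (fun x : ℝ => if x = 0 then 0 else 1) A +
    cfc Real.log A
  rw [← cfc_comp_const_mul c Real.log A ((A.finite_real_spectrum.image _).continuousOn _) hA',
    ← cfc_const_mul _ _ A (continuousOn_spectrum A _),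
    ← cfc_add A _ _ (continuousOn_spectrum A _) (continuousOn_spectrum A _)]
  refine cfc_congr fun x _ => ?_
  by_cases hx : x = 0
  · simp [hx]
  · simp [hx, Real.log_mul hc hx]

lemma relEntropyTrace_smul {n : Type*} [Fintype n] [DecidableEq n] {ρ σ : Matrix n n ℂ}
    (hρ : ρ.IsHermitian) (htr : ρ.trace = 1) (hσ : σ.IsHermitian) (h : SuppLE ρ σ) {p w : ℝ}
    (hp : p ≠ 0) (hw : w ≠ 0) :
    relEntropyTrace ((p : ℂ) • ρ) ((w : ℂ) • σ) =
      p * relEntropyTrace ρ σ + p * (Real.log p - Real.log w) := by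
  have h1 : ρ * (mlog ((p : ℂ) • ρ) - mlog ((w : ℂ) • σ)) =
      ρ * (mlog ρ - mlog σ) + ((Real.log p - Real.log w : ℝ) : ℂ) • ρ := by
    rw [mlog_smul hρ hp, mlog_smul hσ hw, add_sub_add_comm, mul_add, mul_sub, Matrix.mul_smul,
      Matrix.mul_smul, mul_supportProj hρ fun _ hv => hv, mul_supportProj hσ h, ← sub_smul,
      ← Complex.ofReal_sub, add_comm]
  rw [relEntropyTrace, Matrix.smul_mul, h1, Matrix.trace_smul, Matrix.trace_add, Matrix.trace_smul,
    htr, smul_eq_mul, smul_eq_mul, mul_one, Complex.re_ofReal_mul, Complex.add_re,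
    Complex.ofReal_re, relEntropyTrace, mul_add]

lemma relEntropyTrace_blockSum {p w : X → ℝ} (hpw : ∀ x, p x ≠ 0 → w x ≠ 0)
    (N : X → DensityMatrix B) {σ : Matrix B B ℂ} (hσ : σ.IsHermitian)
    (h : ∀ x, p x ≠ 0 → SuppLE (N x).1 σ) :
    relEntropyTrace (blockSum fun x => (p x : ℂ) • (N x).1) (blockSum fun x => (w x : ℂ) • σ) =
      ∑ x, (p x * relEntropyTrace (N x).1 σ + p x * (Real.log (p x) - Real.log (w x))) := by
  have hh : ∀ (c : ℝ) {A : Matrix B B ℂ}, A.IsHermitian → ((c : ℂ) • A).IsHermitian :=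
    fun c _ hA => hA.smul (isSelfAdjoint_ofReal c)
  rw [relEntropyTrace, mlog, mlog, cfc_blockSum _ fun x => hh (p x) (N x).2.1.1,
    cfc_blockSum _ fun x => hh (w x) hσ, blockSum_sub, blockSum_mul, trace_blockSum, Complex.re_sum]
  refine Finset.sum_congr rfl fun x _ => ?_
  by_cases hx : p x = 0
  · simp [hx]
  · exact relEntropyTrace_smul (N x).2.1.1 (N x).2.2 hσ (h x hx) hx (hpw x hx)

end BlockCalculus

/-! ### The sandwiched capacities at finite order. -/

section SandwichedCapacity

variable {n : Type*} [Fintype n] [DecidableEq n]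

/-- The trace functional whose sublevel sets are those of the sandwiched Rényi divergence. -/
def sandwichedValue (a : ℝ) (ρ σ : Matrix n n ℂ) : ℝ :=
  if a = 1 then relEntropyTrace ρ σ
  else if a < 1 then -sandwichedTrace a ρ σ
  else sandwichedTrace a ρ σ

/-- The epigraph of the sandwiched trace functional of order `a`. -/
def sandwichedEpi (a : ℝ) (ρ σ : Matrix n n ℂ) (u : ℝ) : Prop :=
  (1 ≤ a → SuppLE ρ σ) ∧ sandwichedValue a ρ σ ≤ u

lemma sandwichedRenyiDiv_le_iff {α : ℝ≥0∞} (hα : α ≠ ⊤) (ρ σ : Matrix n n ℂ) (r : ℝ) :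
    sandwichedRenyiDiv α ρ σ ≤ r ↔ sandwichedEpi α.toReal ρ σ (levelMap α.toReal r) := by
  by_cases h1 : α = 1
  · subst h1
    simp only [sandwichedRenyiDiv, if_true, ENNReal.toReal_one, sandwichedEpi, sandwichedValue,
      levelMap, le_refl, true_imp_iff, relEntropy]
    by_cases h : SuppLE ρ σ
    · rw [if_pos h, EReal.coe_le_coe_iff]
      exact (and_iff_right h).symm
    · simp [h]
  have h1' : α.toReal ≠ 1 := fun h => h1 (by
    rw [← ENNReal.ofReal_toReal hα, h, ENNReal.ofReal_one])
  have hlt : α < 1 ↔ α.toReal < 1 := by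
    rw [← ENNReal.toReal_one, ENNReal.toReal_lt_toReal hα ENNReal.one_ne_top]
  simp only [sandwichedRenyiDiv, h1, hα, if_false, levelMap, h1', hlt, sandwichedEpi,
    sandwichedValue]
  by_cases hl : α.toReal < 1
  · rw [if_pos (Or.inl (hlt.2 hl)), if_pos hl, if_pos hl, inv_mul_log_le_iff_of_lt_one hl]
    exact ⟨fun h => ⟨fun h' => absurd h' (not_le.2 hl), h⟩, fun h => h.2⟩
  · have hl' : 1 ≤ α.toReal := not_lt.1 hl
    by_cases h : SuppLE ρ σ
    · rw [if_pos (Or.inr h), if_neg hl, if_neg hl,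
        inv_mul_log_le_iff_of_one_lt (lt_of_le_of_ne hl' (Ne.symm h1'))]
      exact ⟨fun h' => ⟨fun _ => h, h'⟩, fun h' => h'.2⟩
    · rw [if_neg (by rw [hlt]; simp only [hl, h, or_self, not_false_eq_true])]
      simp [h, hl']

lemma sandwichedEpi.mono {a : ℝ} {ρ σ : Matrix n n ℂ} {u v : ℝ} (h : sandwichedEpi a ρ σ u)
    (huv : u ≤ v) : sandwichedEpi a ρ σ v :=
  ⟨h.1, h.2.trans huv⟩

lemma sandwichedEpi.convex {a : ℝ} (ha : 1 / 2 ≤ a) {ρ σ₁ σ₂ : Matrix n n ℂ} (hρ : ρ.PosSemidef)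
    (h₁ : σ₁.PosSemidef) (h₂ : σ₂.PosSemidef) {u₁ u₂ s t : ℝ} (hs : 0 < s) (ht : 0 < t)
    (hst : s + t = 1) (hE₁ : sandwichedEpi a ρ σ₁ u₁) (hE₂ : sandwichedEpi a ρ σ₂ u₂) :
    sandwichedEpi a ρ ((s : ℂ) • σ₁ + (t : ℂ) • σ₂) (s * u₁ + t * u₂) := by
  refine ⟨fun h => (hE₁.1 h).mix h₁ h₂ hs ht, le_trans ?_ (add_le_add
    (mul_le_mul_of_nonneg_left hE₁.2 hs.le) (mul_le_mul_of_nonneg_left hE₂.2 ht.le))⟩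
  unfold sandwichedValue
  split_ifs with h1 hlt
  · exact relEntropyTrace_convex hρ h₁ h₂ (hE₁.1 h1.ge) (hE₂.1 h1.ge) hs ht hst
  · have := sandwichedTrace_concave ha hlt hρ h₁ h₂ hs ht hst
    linarith
  · have h : 1 ≤ a := not_lt.1 hlt
    exact sandwichedTrace_convex (lt_of_le_of_ne h (Ne.symm h1)) hρ h₁ h₂ (hE₁.1 h) (hE₂.1 h)
      hs ht hst

/-- Supplies the lower bound, uniform in `σ`, required by the minimax theorem. -/
lemma exists_le_of_sandwichedEpi {a : ℝ} (ha : 0 < a) {ρ : Matrix n n ℂ} (hρ : ρ.PosSemidef)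
    (htr : ρ.trace = 1) :
    ∃ m : ℝ, ∀ (σ : DensityMatrix n) (u : ℝ), sandwichedEpi a ρ σ.1 u → m ≤ u := by
  by_cases h1 : a = 1
  · refine ⟨(ρ * mlog ρ).trace.re, fun σ u h => (le_relEntropyTrace hρ σ.2.1 σ.2.2).trans ?_⟩
    simpa [sandwichedValue, h1] using h.2
  by_cases hlt : a < 1
  · refine ⟨-(Fintype.card n : ℝ), fun σ u h => ?_⟩
    have h2 := h.2
    simp only [sandwichedValue, h1, hlt, if_true, if_false] at h2
    have := sandwichedTrace_le_card ha hlt hρ σ.2.1 htr σ.2.2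
    linarith
  · refine ⟨0, fun σ u h => ?_⟩
    have h2 := h.2
    simp only [sandwichedValue, h1, hlt, if_false] at h2
    exact (sandwichedTrace_nonneg hρ).trans h2

variable {X B : Type*} [Fintype X] [DecidableEq X] [Fintype B] [DecidableEq B]

lemma sandwichedEpi_cqState_iff {a : ℝ} (p : stdSimplex ℝ X)
    (N : X → DensityMatrix B) (σ : DensityMatrix B) {w c : X → ℝ} {d : ℝ}
    (hc : ∀ x, 0 ≤ c x) (hp0 : ∀ x, p.1 x = 0 → c x = 0)
    (hpw : ∀ x, p.1 x ≠ 0 → w x ≠ 0)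
    (hval : (1 ≤ a → ∀ x, p.1 x ≠ 0 → SuppLE (N x).1 σ.1) →
      sandwichedValue a (cqState p N) (blockSum fun x => (w x : ℂ) • σ.1) =
        ∑ x, c x * sandwichedValue a (N x).1 σ.1 + d) (v : ℝ) :
    sandwichedEpi a (cqState p N) (blockSum fun x => (w x : ℂ) • σ.1) v ↔
      ∃ u : X → ℝ, (∀ x, p.1 x ≠ 0 → sandwichedEpi a (N x).1 σ.1 (u x)) ∧
        ∑ x, c x * u x + d ≤ v := by
  have hsupp : SuppLE (cqState p N) (blockSum fun x => (w x : ℂ) • σ.1) ↔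
      ∀ x, p.1 x ≠ 0 → SuppLE (N x).1 σ.1 := by
    rw [cqState_eq]
    exact suppLE_blockSum_iff hpw _ _
  constructor
  · rintro ⟨h1, h2⟩
    have h3 : 1 ≤ a → ∀ x, p.1 x ≠ 0 → SuppLE (N x).1 σ.1 := fun h => hsupp.1 (h1 h)
    exact ⟨fun x => sandwichedValue a (N x).1 σ.1, fun x hx => ⟨fun h => h3 h x hx, le_rfl⟩,
      (hval h3).ge.trans h2⟩
  · rintro ⟨u, hu, hle⟩
    have h3 : 1 ≤ a → ∀ x, p.1 x ≠ 0 → SuppLE (N x).1 σ.1 := fun h x hx => (hu x hx).1 h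
    refine ⟨fun h => hsupp.2 (h3 h), ?_⟩
    rw [hval h3]
    refine le_trans (add_le_add_left (Finset.sum_le_sum fun x _ => ?_) d) hle
    by_cases hx : p.1 x = 0
    · simp [hp0 x hx]
    · exact mul_le_mul_of_nonneg_left (hu x hx).2 (hc x)

lemma sandwichedValue_cqState {a : ℝ} (h1 : a ≠ 1) (p : stdSimplex ℝ X) (N : X → DensityMatrix B)
    (σ : DensityMatrix B) {w : X → ℝ} (hw : ∀ x, 0 ≤ w x) :
    sandwichedValue a (cqState p N) (blockSum fun x => (w x : ℂ) • σ.1) =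
      ∑ x, (w x ^ ((1 - a) / (2 * a)) * p.1 x * w x ^ ((1 - a) / (2 * a))) ^ a *
        sandwichedValue a (N x).1 σ.1 := by
  have h := sandwichedTrace_blockSum a p.2.1 hw (fun x => (N x).2.1) σ.2.1
  rw [← cqState_eq] at h
  simp only [sandwichedValue, h1, if_false, h]
  split_ifs
  · simp only [mul_neg, Finset.sum_neg_distrib]
  · rfl

lemma sandwichedValue_one_cqState (p : stdSimplex ℝ X) (N : X → DensityMatrix B)
    (σ : DensityMatrix B) {w : X → ℝ} (hpw : ∀ x, p.1 x ≠ 0 → w x ≠ 0)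
    (h : ∀ x, p.1 x ≠ 0 → SuppLE (N x).1 σ.1) :
    sandwichedValue 1 (cqState p N) (blockSum fun x => (w x : ℂ) • σ.1) =
      ∑ x, p.1 x * sandwichedValue 1 (N x).1 σ.1 +
        ∑ x, p.1 x * (Real.log (p.1 x) - Real.log (w x)) := by
  simp only [sandwichedValue, if_true]
  rw [cqState_eq, relEntropyTrace_blockSum hpw N σ.2.1.1 h, Finset.sum_add_distrib]

lemma sandwiched_inputState_le_iff {α : ℝ≥0∞} (h0 : α ≠ 0) (hα : α ≠ ⊤) (p : stdSimplex ℝ X)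
    (N : X → DensityMatrix B) (σ : DensityMatrix B) (r : ℝ) :
    renyiDiv Family.sandwiched α (cqState p N) (inputState p ⊗ₖ σ.1) ≤ r ↔
      ∃ u : X → ℝ, (∀ x, p.1 x ≠ 0 → sandwichedEpi α.toReal (N x).1 σ.1 (u x)) ∧
        ∑ x, p.1 x * u x ≤ levelMap α.toReal r := by
  have ha : α.toReal ≠ 0 := ENNReal.toReal_ne_zero.2 ⟨h0, hα⟩
  have h := sandwichedEpi_cqState_iff (a := α.toReal) p N σ (w := p.1) (c := p.1) (d := 0)
    p.2.1 (fun x hx => hx) (fun x hx => hx) (fun hs => by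
      rw [add_zero]
      by_cases h1 : α.toReal = 1
      · rw [h1, sandwichedValue_one_cqState p N σ (fun x hx => hx) (hs h1.ge)]
        simp
      · rw [sandwichedValue_cqState h1 p N σ p.2.1]
        refine Finset.sum_congr rfl fun x _ => ?_
        congr 1
        rcases (p.2.1 x).eq_or_lt with hx | hx
        · rw [← hx, mul_zero, zero_mul, Real.zero_rpow ha]
        · have e1 : p.1 x ^ ((1 - α.toReal) / (2 * α.toReal)) * p.1 x *
              p.1 x ^ ((1 - α.toReal) / (2 * α.toReal)) = p.1 x ^ (1 / α.toReal) := by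
            conv_lhs => enter [1, 2]; rw [← Real.rpow_one (p.1 x)]
            rw [← Real.rpow_add hx, ← Real.rpow_add hx]
            congr 1
            field_simp
            ring
          rw [e1, ← Real.rpow_mul hx.le, one_div_mul_cancel ha, Real.rpow_one])
    (levelMap α.toReal r)
  simp only [add_zero] at h
  rw [inputState, diagonal_kronecker_eq, ← h]
  exact sandwichedRenyiDiv_le_iff hα _ _ r

lemma sandwiched_one_le_iff {α : ℝ≥0∞} (h0 : α ≠ 0) (hα : α ≠ ⊤) (p : stdSimplex ℝ X)
    (N : X → DensityMatrix B) (σ : DensityMatrix B) (r : ℝ) :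
    renyiDiv Family.sandwiched α (cqState p N) ((1 : Matrix X X ℂ) ⊗ₖ σ.1) ≤ r ↔
      ∃ u : X → ℝ, (∀ x, p.1 x ≠ 0 → sandwichedEpi α.toReal (N x).1 σ.1 (u x)) ∧
        ∑ x, p.1 x ^ α.toReal * u x + (if α = 1 then ∑ x, p.1 x * Real.log (p.1 x) else 0) ≤
          levelMap α.toReal r := by
  have ha : α.toReal ≠ 0 := ENNReal.toReal_ne_zero.2 ⟨h0, hα⟩
  rw [one_kronecker_eq, ← sandwichedEpi_cqState_iff (a := α.toReal) p N σ (w := fun _ => 1)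
    (c := fun x => p.1 x ^ α.toReal) (fun x => Real.rpow_nonneg (p.2.1 x) _)
    (fun x hx => by rw [hx, Real.zero_rpow ha]) (fun _ _ => one_ne_zero) (fun hs => by
      by_cases h1 : α.toReal = 1
      · rw [h1, sandwichedValue_one_cqState p N σ (fun _ _ => one_ne_zero) (hs h1.ge),
          if_pos ((ENNReal.toReal_eq_one_iff α).1 h1)]
        simp
      · rw [sandwichedValue_cqState h1 p N σ (fun _ => zero_le_one),
          if_neg fun h => h1 ((ENNReal.toReal_eq_one_iff α).2 h)]
        simp)
    (levelMap α.toReal r)]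
  exact sandwichedRenyiDiv_le_iff hα _ _ r

theorem sandwiched_renyiCapacity_eq_divergenceRadius [Nonempty X] {α : ℝ≥0∞} (h : 1 / 2 ≤ α)
    (hα : α ≠ ⊤) (N : X → DensityMatrix B) :
    renyiCapacity Family.sandwiched α N = divergenceRadius Family.sandwiched α N := by
  have ha : 1 / 2 ≤ α.toReal := by
    have := (ENNReal.toReal_le_toReal (by simp) hα).2 h
    simpa using this
  have h0 : α ≠ 0 := fun h0 => by simp [h0] at h
  choose m hm using fun x => exists_le_of_sandwichedEpi (a := α.toReal) (by linarith) (N x).2.1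
    (N x).2.2
  exact iSup_iInf_eq_iInf_iSup_of_epigraph
    (fun x (σ : DensityMatrix B) => renyiDiv Family.sandwiched α (N x).1 σ.1)
    (fun p σ => renyiDiv Family.sandwiched α (cqState p N) (inputState p ⊗ₖ σ.1))
    (levelMap α.toReal) (levelMap_strictMono _)
    (fun x σ u => sandwichedEpi α.toReal (N x).1 σ.1 u)
    (fun _ _ _ _ h huv => h.mono huv)
    (fun x σ r => sandwichedRenyiDiv_le_iff hα (N x).1 σ.1 r)
    (fun p σ r => sandwiched_inputState_le_iff h0 hα p N σ r)
    (fun σ₁ σ₂ _ _ _ _ hs ht hst h₁ h₂ => ⟨σ₁.mix σ₂ hs ht hst, fun x =>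
      sandwichedEpi.convex ha (N x).2.1 σ₁.2.1 σ₂.2.1 hs ht hst (h₁ x) (h₂ x)⟩)
    m hm

theorem sandwiched_arimotoCapacity_eq_renyiCapacity {α : ℝ≥0∞} (h0 : α ≠ 0)
    (hα : α ≠ ⊤) (N : X → DensityMatrix B) :
    arimotoCapacity Family.sandwiched α N = renyiCapacity Family.sandwiched α N :=
  arimotoCapacity_eq_renyiCapacity_of_epigraph Family.sandwiched h0 hα N
    (fun x σ u => sandwichedEpi α.toReal (N x).1 σ.1 u)
    (fun p σ r => sandwiched_inputState_le_iff h0 hα p N σ r)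
    (fun p σ r => sandwiched_one_le_iff h0 hα p N σ r)

end SandwichedCapacity

end CQRenyi

end

/-! ### Assembly of finite and infinite orders. -/

theorem mainTheorem4 {X B : Type*} [Fintype X] [DecidableEq X] [Nonempty X]
    [Fintype B] [DecidableEq B] (N : X → CQRenyi.DensityMatrix B) :
    (∀ α : ENNReal,
      CQRenyi.renyiCapacity CQRenyi.Family.measured α N =
        CQRenyi.divergenceRadius CQRenyi.Family.measured α N) ∧
    (∀ α : ENNReal, 0 < α →
      CQRenyi.arimotoCapacity CQRenyi.Family.measured α N =
        CQRenyi.renyiCapacity CQRenyi.Family.measured α N) ∧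
    (∀ α : ENNReal, 1 / 2 ≤ α →
      CQRenyi.renyiCapacity CQRenyi.Family.sandwiched α N =
          CQRenyi.divergenceRadius CQRenyi.Family.sandwiched α N ∧
        CQRenyi.arimotoCapacity CQRenyi.Family.sandwiched α N =
          CQRenyi.renyiCapacity CQRenyi.Family.sandwiched α N) := by
  have htop : ∀ t, CQRenyi.renyiCapacity t ⊤ N = CQRenyi.divergenceRadius t ⊤ N ∧
      CQRenyi.arimotoCapacity t ⊤ N = CQRenyi.renyiCapacity t ⊤ N := fun t =>
    ⟨CQRenyi.renyiCapacity_top_eq_divergenceRadius t N,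
      (CQRenyi.arimotoCapacity_top_eq_divergenceRadius t N).trans
        (CQRenyi.renyiCapacity_top_eq_divergenceRadius t N).symm⟩
  refine ⟨fun α => ?_, fun α h => ?_, fun α h => ?_⟩
  · by_cases hα : α = ⊤
    · exact hα ▸ (htop _).1
    · exact CQRenyi.measured_renyiCapacity_eq_divergenceRadius hα N
  · by_cases hα : α = ⊤
    · exact hα ▸ (htop _).2
    · exact CQRenyi.measured_arimotoCapacity_eq_renyiCapacity h.ne' hα N
  · by_cases hα : α = ⊤
    · exact hα ▸ htop _
    · have h0 : α ≠ 0 := fun h0 => by simp [h0] at h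
      exact ⟨CQRenyi.sandwiched_renyiCapacity_eq_divergenceRadius h hα N,
        CQRenyi.sandwiched_arimotoCapacity_eq_renyiCapacity h0 hα N⟩
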